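/- Let $\mathbb H$ be a separable complex Hilbert space with a fixed complete orthonormal system $\{e_j\}$ (the "real" basis), let $\overline{x}=\sum_j\overline{\langle x,e_j\rangle}e_j$, call $x$ real if $\overline x=x$, and let $[x\otimes y](z)=\langle z,y\rangle x$. For a bounded operator $A$ on $\mathbb H$ put $\|A\|_{\rm tr}=\sum_j\langle (A^*A)^{1/2}e_j,e_j\rangle$ and $\|A\|_{\rm HS}=(\sum_j\|Ae_j\|^2)^{1/2}$, and let $\langle A,B\rangle_{\rm HS}={\rm trace}(A^*B)$. Let $X=\{X(t),\,t\in\mathbb R^d\}$ be a zero-mean, second-order stationary, real $\mathbb H$-valued process: $\mathbb E\|X(t)\|^2<\infty$, and $\mathbb E[X(t)\otimes X(s)]$ and $\mathbb E[X(t)\otimes\overline{X(s)}]$ depend only on $t-s$. Write $C(h)=\mathbb E[X(h)\otimes X(0)]$. Assume the following. (C) $\int_{\mathbb R^d}\|C(h)\|_{\rm tr}\,dh<\infty$, and for some $0<\gamma\le 1$, $M_0<\infty$ and $\delta_0>0$, $$\int_{\mathbb R^d}\sup_{y:\|x-y\|\le\delta}\|C(y)-C(x)\|_{\rm tr}\,dx\le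 M_0\,\delta^\gamma\qquad\text{for all }0<\delta\le\delta_0 .$$ (K) $K:\mathbb R^d\to[0,\infty)$ is Lipschitz continuous, $S_K=\{u:K(u)>0\}$ is bounded, $\sup_u K(u)=K(0)=1$, and $K$ is differentiable with bounded gradient in some ball around $0$. (S) For each $n$ the process is observed at distinct points $t_{n,1},\dots,t_{n,n}\in\mathbb R^d$. Let $\mathbb T_n$ be the set of these points, $T_n$ its closed convex hull, $|\cdot|$ Lebesgue measure, $V(t_{n,i})=\{x\in T_n:\|x-t_{n,i}\|\le\|x-t_{n,j}\|\ \forall j\}$ the Voronoi cells, and $\delta_n=\max_i\sup_{x\in V(t_{n,i})}\|x-t_{n,i}\|$. Then $\delta_n\to0$, $|T_n|\to\infty$, and $T_n/|T_n|^{1/d}\to T$ in the Hausdorff metric for some bounded convex set $T$ with non-empty interior. (V) $\mathbb E\|X(t)\|^4<\infty$ for all $t$. The fourth-order cumulant $${\rm cum}(Y_1,Y_2,Y_3,Y_4)=\mathbb E\langle Y_1\otimes Y_2,Y_3\otimes Y_4\rangle_{\rm HS}-\langle\mathbb E(Y_1\otimes Y_2),\mathbb E(Y_3\otimes Y_4)\rangle_{\rm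 HS}-\mathbb E\langle Y_1,Y_3\rangle\,\mathbb E\langle Y_4,Y_2\rangle-\langle\mathbb E(Y_1\otimes\overline{Y_4}),\mathbb E(Y_3\otimes\overline{Y_2})\rangle_{\rm HS}$$ satisfies ${\rm cum}(X(t+\tau),X(s+\tau),X(w+\tau),X(v+\tau))={\rm cum}(X(t),X(s),X(w),X(v))$ for all $t,s,w,v,\tau$, and for some $\delta>0$ $$\sup_{w}\int\!\!\int\sup_{\|\lambda_1\|,\|\lambda_2\|,\|\lambda_3\|<\delta}|{\rm cum}(X(\lambda_1+u),X(\lambda_2+v),X(\lambda_3+w),X(0))|\,dv\,du<\infty .$$ Let $\Delta_n>0$ satisfy $\Delta_n\to\infty$, $\Delta_n^d/|T_n|\to0$, and $\Delta_n S_K\subset T_n-T_n$ for all sufficiently large $n$. Let $f(\theta)=(2\pi)^{-d}\int e^{\mathbf i h^\top\theta}C(h)\,dh$ be the spectral density and $$\hat f_n(\theta)=\frac1{(2\pi)^d}\sum_{t,s\in\mathbb T_n}e^{\mathbf i(t-s)^\top\theta}\,\frac{X(t)\otimes X(s)}{|T_n\cap(T_n-(t-s))|}\,K\Big(\frac{t-s}{\Delta_n}\Big)|V(t)|\,|V(s)|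 ,$$ and put $$B_1(\Delta_n;\theta)=\Big\|\int_{\Delta_nS_K}e^{\mathbf i h^\top\theta}C(h)\Big(1-K\Big(\frac h{\Delta_n}\Big)\Big)dh\Big\|_{\rm HS},\qquad B_2(\Delta_n;\theta)=\Big\|\int_{\mathbb R^d\setminus\Delta_nS_K}e^{\mathbf i h^\top\theta}C(h)\,dh\Big\|_{\rm HS}.$$ Then for every bounded $\Theta\subset\mathbb R^d$, $$\big(\mathbb E\|\hat f_n(\theta)-f(\theta)\|_{\rm HS}^2\big)^{1/2}=\mathcal O\Big(\delta_n^\gamma+B_1(\Delta_n;\theta)+B_2(\Delta_n;\theta)+\sqrt{\Delta_n^d/|T_n|}\Big)\qquad(n\to\infty)$$ uniformly in $\theta\in\Theta$: there are $M<\infty$ and $n_0$ such that for all $n\ge n_0$ and all $\theta\in\Theta$ the left-hand side is at most $M$ times the expression in parentheses. In particular, the same bound holds with the supremum over $\theta\in\Theta$ of the left-hand side and of $B_1,B_2$. -/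

import Mathlib

open Filter MeasureTheory Topology
open scoped ENNReal NNReal Pointwise

noncomputable section

namespace SpectralDensity

/-! ### Operators on a complex Hilbert space with a designated (real) orthonormal basis -/

section Operators

variable {ι H : Type*} [NormedAddCommGroup H] [InnerProductSpace ℂ H]

/-- The cross product `x ⊗ y`, i.e. the operator `z ↦ ⟨z, y⟩ x` (linear in `z`). -/
def outer (x y : H) : H →L[ℂ] H := InnerProductSpace.rankOne ℂ x y

/-- Complex conjugation with respect to the basis `b`: coordinates are conjugated. -/
def conj (b : HilbertBasis ι ℂ H) (x : H) : H := b.repr.symm (star (b.repr x))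

/-- The trace norm `∑ⱼ ⟨(A⋆A)^{1/2} eⱼ, eⱼ⟩`, with values in `[0, ∞]`. -/
def traceNorm [CompleteSpace H] (b : HilbertBasis ι ℂ H) (A : H →L[ℂ] H) : ℝ≥0∞ :=
  ∑' j, ENNReal.ofReal (inner ℂ (CFC.abs A (b j)) (b j)).re

/-- The Hilbert-Schmidt norm `(∑ⱼ ‖A eⱼ‖²)^{1/2}`, with values in `[0, ∞]`. -/
def hsNorm (b : HilbertBasis ι ℂ H) (A : H →L[ℂ] H) : ℝ≥0∞ :=
  (∑' j, ‖A (b j)‖ₑ ^ 2) ^ (1 / 2 : ℝ)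

/-- The Hilbert-Schmidt inner product `trace (A⋆ B) = ∑ⱼ ⟨A eⱼ, B eⱼ⟩`
(antilinear in the first argument, as is Mathlib's inner product). -/
def hsInner (b : HilbertBasis ι ℂ H) (A B : H →L[ℂ] H) : ℂ :=
  ∑' j, inner ℂ (A (b j)) (B (b j))

end Operators

/-! ### Second-order structure of Hilbert-space valued processes -/

section StochProc

variable {d : ℕ} {ι H Ω : Type*} [NormedAddCommGroup H] [InnerProductSpace ℂ H]
  [CompleteSpace H] [MeasurableSpace Ω]

/-- The cross-covariance operator `𝔼[Y ⊗ Z]` of zero-mean random elements (Bochner integral). -/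
def covOp (P : Measure Ω) (Y Z : Ω → H) : H →L[ℂ] H := ∫ ω, outer (Y ω) (Z ω) ∂P

/-- A zero-mean second-order process `X` on `ℝᵈ` whose covariance operator `𝔼[X(t) ⊗ X(s)]` and
pseudo-covariance operator `𝔼[X(t) ⊗ conj X(s)]` depend only on the lag `t - s`. -/
structure IsSecondOrderStationary (b : HilbertBasis ι ℂ H) (P : Measure Ω)
    (X : EuclideanSpace ℝ (Fin d) → Ω → H) : Prop where
  memLp : ∀ t, MemLp (X t) 2 P
  mean_zero : ∀ t, ∫ ω, X t ω ∂P = 0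
  cov_shift : ∀ t s τ, covOp P (X (t + τ)) (X (s + τ)) = covOp P (X t) (X s)
  pseudoCov_shift : ∀ t s τ,
    covOp P (X (t + τ)) (fun ω => conj b (X (s + τ) ω))
      = covOp P (X t) (fun ω => conj b (X s ω))

/-- The process takes (almost surely) values in the real part of `H`. -/
def IsRealProcess (b : HilbertBasis ι ℂ H) (P : Measure Ω)
    (X : EuclideanSpace ℝ (Fin d) → Ω → H) : Prop :=
  ∀ t, ∀ᵐ ω ∂P, conj b (X t ω) = X t ω

/-- The stationary covariance operator `C(h) = 𝔼[X(h) ⊗ X(0)]`. -/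
def stationaryCov (P : Measure Ω) (X : EuclideanSpace ℝ (Fin d) → Ω → H)
    (h : EuclideanSpace ℝ (Fin d)) : H →L[ℂ] H :=
  covOp P (X h) (X 0)

/-- The fourth-order cumulant of zero-mean random elements of `H`. -/
def cum (b : HilbertBasis ι ℂ H) (P : Measure Ω) (Y₁ Y₂ Y₃ Y₄ : Ω → H) : ℂ :=
  (∫ ω, hsInner b (outer (Y₁ ω) (Y₂ ω)) (outer (Y₃ ω) (Y₄ ω)) ∂P)
    - hsInner b (covOp P Y₁ Y₂) (covOp P Y₃ Y₄)
    - (∫ ω, inner ℂ (Y₁ ω) (Y₃ ω) ∂P) * (∫ ω, inner ℂ (Y₄ ω) (Y₂ ω) ∂P)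
    - hsInner b (covOp P Y₁ (fun ω => conj b (Y₄ ω))) (covOp P Y₃ (fun ω => conj b (Y₂ ω)))

/-- The character `e^{i hᵀθ}`. -/
def character (h θ : EuclideanSpace ℝ (Fin d)) : ℂ :=
  Complex.exp (Complex.I * ((inner ℝ h θ : ℝ) : ℂ))

/-- The spectral density `f(θ) = (2π)⁻ᵈ ∫ e^{i hᵀθ} C(h) dh` (Bochner integral). -/
def spectralDensity (P : Measure Ω) (X : EuclideanSpace ℝ (Fin d) → Ω → H)
    (θ : EuclideanSpace ℝ (Fin d)) : H →L[ℂ] H :=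
  (((2 * Real.pi) ^ d : ℝ)⁻¹ : ℂ) • ∫ h, character h θ • stationaryCov P X h

end StochProc

/-! ### The sampling design -/

section Design

variable {d n : ℕ}

/-- The sampling region: the closed convex hull of the observed locations. -/
def region (t : Fin n → EuclideanSpace ℝ (Fin d)) : Set (EuclideanSpace ℝ (Fin d)) :=
  closure (convexHull ℝ (Set.range t))

/-- The Voronoi cell of the `i`-th location, within the sampling region. -/
def cell (t : Fin n → EuclideanSpace ℝ (Fin d)) (i : Fin n) : Set (EuclideanSpace ℝ (Fin d)) :=
  {x | x ∈ region t ∧ ∀ j, ‖x - t i‖ ≤ ‖x - t j‖}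

/-- The diameter `max_i sup_{x ∈ V(tᵢ)} ‖x - tᵢ‖` of the Voronoi tessellation. -/
def tessDiam (t : Fin n → EuclideanSpace ℝ (Fin d)) : ℝ :=
  ⨆ i, ⨆ x : cell t i, ‖(x : EuclideanSpace ℝ (Fin d)) - t i‖

/-- The Lebesgue measure `|T|` of the sampling region. -/
def regionVol (t : Fin n → EuclideanSpace ℝ (Fin d)) : ℝ := volume.real (region t)

/-- The volume `|T ∩ (T - h)|`. -/
def overlapVol (t : Fin n → EuclideanSpace ℝ (Fin d)) (h : EuclideanSpace ℝ (Fin d)) : ℝ :=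
  volume.real (region t ∩ (fun x => x - h) '' region t)

/-- The set `S_K` on which the kernel is positive. -/
def kernelSupp (K : EuclideanSpace ℝ (Fin d) → ℝ) : Set (EuclideanSpace ℝ (Fin d)) :=
  {u | 0 < K u}

end Design

/-! ### Estimator and bias terms -/

section Estimator

variable {d n : ℕ} {ι H Ω : Type*} [NormedAddCommGroup H] [InnerProductSpace ℂ H]
  [CompleteSpace H] [MeasurableSpace Ω]

/-- The estimator `f̂(θ)` computed from the observations of `X` at the locations `tᵢ`,
with kernel `K` and bandwidth `Δ`. -/
def estimator (X : EuclideanSpace ℝ (Fin d) → Ω → H) (K : EuclideanSpace ℝ (Fin d) → ℝ)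
    (t : Fin n → EuclideanSpace ℝ (Fin d)) (Δ : ℝ) (θ : EuclideanSpace ℝ (Fin d)) (ω : Ω) :
    H →L[ℂ] H :=
  (((2 * Real.pi) ^ d : ℝ)⁻¹ : ℂ) • ∑ i, ∑ j,
    (character (t i - t j) θ *
      ((K (Δ⁻¹ • (t i - t j)) * volume.real (cell t i) * volume.real (cell t j)
        / overlapVol t (t i - t j) : ℝ) : ℂ)) • outer (X (t i) ω) (X (t j) ω)

/-- The root mean square error `(𝔼 ‖f̂(θ) - f(θ)‖²_HS)^{1/2}`. -/
def rootMSE (b : HilbertBasis ι ℂ H) (P : Measure Ω) (X : EuclideanSpace ℝ (Fin d) → Ω → H)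
    (K : EuclideanSpace ℝ (Fin d) → ℝ) (t : Fin n → EuclideanSpace ℝ (Fin d)) (Δ : ℝ)
    (θ : EuclideanSpace ℝ (Fin d)) : ℝ≥0∞ :=
  (∫⁻ ω, hsNorm b (estimator X K t Δ θ ω - spectralDensity P X θ) ^ 2 ∂P) ^ (1 / 2 : ℝ)

/-- `B₁(Δ; θ) = ‖∫_{Δ S_K} e^{i hᵀθ} C(h) (1 - K(h/Δ)) dh‖_HS`. -/
def biasKernel (b : HilbertBasis ι ℂ H) (P : Measure Ω) (X : EuclideanSpace ℝ (Fin d) → Ω → H)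
    (K : EuclideanSpace ℝ (Fin d) → ℝ) (Δ : ℝ) (θ : EuclideanSpace ℝ (Fin d)) : ℝ≥0∞ :=
  hsNorm b (∫ h in Δ • kernelSupp K,
    (character h θ * ((1 - K (Δ⁻¹ • h) : ℝ) : ℂ)) • stationaryCov P X h)

/-- `B₂(Δ; θ) = ‖∫_{h ∉ Δ S_K} e^{i hᵀθ} C(h) dh‖_HS`. -/
def biasTail (b : HilbertBasis ι ℂ H) (P : Measure Ω) (X : EuclideanSpace ℝ (Fin d) → Ω → H)
    (K : EuclideanSpace ℝ (Fin d) → ℝ) (Δ : ℝ) (θ : EuclideanSpace ℝ (Fin d)) : ℝ≥0∞ :=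
  hsNorm b (∫ h in (Δ • kernelSupp K)ᶜ, character h θ • stationaryCov P X h)

end Estimator

/-! ### Assumptions -/

section Assumptions

variable {d : ℕ} {ι H Ω : Type*} [NormedAddCommGroup H] [InnerProductSpace ℂ H]
  [CompleteSpace H] [MeasurableSpace Ω]

/-- The covariance is integrable in trace norm and `L¹`-`γ`-Hölder (at all small scales `δ`). -/
structure CovarianceAssumption (b : HilbertBasis ι ℂ H) (P : Measure Ω)
    (X : EuclideanSpace ℝ (Fin d) → Ω → H) (γ : ℝ) : Prop where
  aestronglyMeasurable : AEStronglyMeasurable (stationaryCov P X) volume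
  integrable : (∫⁻ h, traceNorm b (stationaryCov P X h)) < ∞
  gamma_pos : 0 < γ
  gamma_le_one : γ ≤ 1
  holder : ∃ M : ℝ≥0, ∃ δ₀ > (0 : ℝ), ∀ δ : ℝ, 0 < δ → δ ≤ δ₀ →
    (∫⁻ x, ⨆ y ∈ Metric.closedBall x δ,
      traceNorm b (stationaryCov P X y - stationaryCov P X x)) ≤ M * ENNReal.ofReal (δ ^ γ)

/-- The kernel is nonnegative, Lipschitz continuous, of bounded support, with maximum `K(0) = 1`,
and differentiable with bounded gradient near `0`. -/
structure KernelAssumption (K : EuclideanSpace ℝ (Fin d) → ℝ) : Prop where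
  nonneg : ∀ u, 0 ≤ K u
  lipschitz : ∃ L : ℝ≥0, LipschitzWith L K
  isBounded_supp : Bornology.IsBounded (kernelSupp K)
  at_zero : K 0 = 1
  le_one : ∀ u, K u ≤ 1
  differentiable_near : ∃ ε > (0 : ℝ), (∀ u ∈ Metric.ball 0 ε, DifferentiableAt ℝ K u) ∧
    ∃ M : ℝ, ∀ u ∈ Metric.ball 0 ε, ‖gradient K u‖ ≤ M

/-- Mixed-domain asymptotics for the designs `(t n i)_{i < n}`: distinct locations, tessellation
diameter tending to zero, volume of the sampling region tending to infinity, and convergence in the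
Hausdorff distance of the rescaled region to a bounded convex set with non-empty interior. -/
structure SamplingAssumption (t : (n : ℕ) → Fin n → EuclideanSpace ℝ (Fin d)) : Prop where
  distinct : ∀ n, Function.Injective (t n)
  diam_tendsto : Tendsto (fun n => tessDiam (t n)) atTop (𝓝 0)
  vol_tendsto : Tendsto (fun n => regionVol (t n)) atTop atTop
  shape : ∃ T : Set (EuclideanSpace ℝ (Fin d)), Bornology.IsBounded T ∧ Convex ℝ T ∧
    (interior T).Nonempty ∧
    Tendsto (fun n => Metric.hausdorffEDist
      ((regionVol (t n) ^ (1 / (d : ℝ)))⁻¹ • region (t n)) T) atTop (𝓝 0)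

/-- Fourth moments, stationarity of fourth-order cumulants and their integrability. -/
structure CumulantAssumption (b : HilbertBasis ι ℂ H) (P : Measure Ω)
    (X : EuclideanSpace ℝ (Fin d) → Ω → H) : Prop where
  memLp : ∀ t, MemLp (X t) 4 P
  stationary : ∀ t s w v τ,
    cum b P (X (t + τ)) (X (s + τ)) (X (w + τ)) (X (v + τ)) = cum b P (X t) (X s) (X w) (X v)
  integrable : ∃ δ > (0 : ℝ),
    (⨆ w, ∫⁻ u, ∫⁻ v, ⨆ l₁ ∈ Metric.ball (0 : EuclideanSpace ℝ (Fin d)) δ,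
      ⨆ l₂ ∈ Metric.ball (0 : EuclideanSpace ℝ (Fin d)) δ,
      ⨆ l₃ ∈ Metric.ball (0 : EuclideanSpace ℝ (Fin d)) δ,
        ‖cum b P (X (l₁ + u)) (X (l₂ + v)) (X (l₃ + w)) (X 0)‖ₑ) < ∞

end Assumptions

end SpectralDensity

end

/-
The error splits into a deterministic part and a centred fluctuation.

The mean of the estimator is a Riemann sum over products of Voronoi cells. For locations `x`, `y` in
the region, the number of pairs with `x - y = h` is measured by the overlap volume `|T ∩ (T - h)|`,
which is exactly the edge correction, so the Riemann sum approximates `∫ e^{i hᵀθ} K(h/Δ) C(h) dh`.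
Moving the end points of a lag within their cells costs `δ` times the Lipschitz constant of the
weights plus the integrated oscillation of `C`, in total `O(δ^γ)`. What remains of the deterministic
part is `B₁` and `B₂`.

The second moment of the fluctuation is a fourfold sum over the locations of covariances of the
operators `X(t) ⊗ X(s)`. For real processes each of them is a fourth-order cumulant plus two
products of covariances, and its sum over two of the locations is bounded by an integral that is
finite by assumption. The support of the kernel bounds the other two sums by `|T| Δ^d`, and the
weights are `O(1/|T|)`, which leaves `Δ^d/|T|`.
-/

noncomputable section

namespace SpectralDensity

/-! ### Hilbert-Schmidt norm -/

section HilbertSchmidt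

variable {ι H : Type*} [NormedAddCommGroup H] [InnerProductSpace ℂ H]

theorem countable_of_orthonormal [TopologicalSpace.SeparableSpace H] {v : ι → H}
    (hv : Orthonormal ℂ v) : Countable ι := by
  refine Pairwise.countable_of_isOpen_disjoint (s := fun i => Metric.ball (v i) (1 / 2))
    (fun i j hij => Metric.ball_disjoint_ball ?_) (fun i => Metric.isOpen_ball)
    fun i => ⟨v i, Metric.mem_ball_self one_half_pos⟩
  have hsq : ‖v i - v j‖ ^ 2 = 2 := by
    rw [norm_sub_sq (𝕜 := ℂ), hv.2 hij, hv.1 i, hv.1 j]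
    norm_num
  rw [dist_eq_norm]
  nlinarith [norm_nonneg (v i - v j)]

theorem enorm_inner_le (x y : H) : ‖inner ℂ x y‖ₑ ≤ ‖x‖ₑ * ‖y‖ₑ := by
  simpa only [enorm_eq_nnnorm, ← ENNReal.coe_mul, ENNReal.coe_le_coe]
    using nnnorm_inner_le_nnnorm (𝕜 := ℂ) x y

theorem norm_inner_le_sq_add_sq (x y : H) : ‖inner ℂ x y‖ ≤ ‖x‖ ^ 2 + ‖y‖ ^ 2 :=
  (norm_inner_le_norm x y).trans (by nlinarith [sq_nonneg (‖x‖ - ‖y‖)])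

theorem hasSum_norm_inner_sq (b : HilbertBasis ι ℂ H) (x : H) :
    HasSum (fun j => ‖inner ℂ (b j) x‖ ^ 2) (‖x‖ ^ 2) := by
  convert (b.hasSum_inner_mul_inner x x).mapL Complex.reCLM using 1
  · ext j
    rw [← inner_conj_symm x (b j), Complex.conj_mul', Complex.reCLM_apply]
    norm_cast
  · exact (inner_self_eq_norm_sq (𝕜 := ℂ) x).symm

theorem tsum_enorm_inner_sq (b : HilbertBasis ι ℂ H) (x : H) :
    ∑' j, ‖inner ℂ (b j) x‖ₑ ^ 2 = ‖x‖ₑ ^ 2 := by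
  simp only [← ofReal_norm, ← ENNReal.ofReal_pow (norm_nonneg _)]
  rw [← (hasSum_norm_inner_sq b x).tsum_eq,
    ENNReal.ofReal_tsum_of_nonneg (fun j => by positivity) (hasSum_norm_inner_sq b x).summable]

theorem hsNorm_sq (b : HilbertBasis ι ℂ H) (A : H →L[ℂ] H) :
    hsNorm b A ^ 2 = ∑' j, ‖A (b j)‖ₑ ^ 2 := by
  rw [hsNorm, ← ENNReal.rpow_natCast, ← ENNReal.rpow_mul]
  norm_num

/-- The values of an operator at finitely many elements of the basis, as a vector of the Euclidean
product: the Hilbert-Schmidt norm is the supremum of the norms of these vectors, from which it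
inherits the properties of a norm. -/
def basisValues (b : HilbertBasis ι ℂ H) (F : Finset ι) :
    (H →L[ℂ] H) →L[ℂ] PiLp 2 (fun _ : F => H) :=
  ((PiLp.continuousLinearEquiv 2 ℂ (fun _ : F => H)).symm :
      ((_ : F) → H) →L[ℂ] PiLp 2 (fun _ : F => H)) ∘L
    ContinuousLinearMap.pi (fun j : F => ContinuousLinearMap.apply ℂ H (b j))

theorem enorm_basisValues_sq (b : HilbertBasis ι ℂ H) (F : Finset ι) (A : H →L[ℂ] H) :
    ‖basisValues b F A‖ₑ ^ 2 = ∑ j ∈ F, ‖A (b j)‖ₑ ^ 2 := by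
  have h : ‖basisValues b F A‖ ^ 2 = ∑ j ∈ F, ‖A (b j)‖ ^ 2 := by
    rw [PiLp.norm_sq_eq_of_L2, ← Finset.sum_coe_sort F]
    rfl
  simp only [← ofReal_norm, ← ENNReal.ofReal_pow (norm_nonneg _)]
  rw [h, ENNReal.ofReal_sum_of_nonneg (fun _ _ => by positivity)]

theorem hsNorm_eq_iSup (b : HilbertBasis ι ℂ H) (A : H →L[ℂ] H) :
    hsNorm b A = ⨆ F : Finset ι, ‖basisValues b F A‖ₑ := by
  refine (ENNReal.pow_right_strictMono two_ne_zero).injective ?_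
  simp only [hsNorm_sq, ENNReal.tsum_eq_iSup_sum, ENNReal.iSup_pow, enorm_basisValues_sq]

theorem enorm_basisValues_le (b : HilbertBasis ι ℂ H) (F : Finset ι) (A : H →L[ℂ] H) :
    ‖basisValues b F A‖ₑ ≤ hsNorm b A :=
  hsNorm_eq_iSup b A ▸ le_iSup (fun F : Finset ι => ‖basisValues b F A‖ₑ) F

theorem hsNorm_zero (b : HilbertBasis ι ℂ H) : hsNorm b 0 = 0 := by
  simp only [hsNorm_eq_iSup, map_zero, enorm_zero, ENNReal.iSup_zero]

theorem hsNorm_smul (b : HilbertBasis ι ℂ H) (c : ℂ) (A : H →L[ℂ] H) :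
    hsNorm b (c • A) = ‖c‖ₑ * hsNorm b A := by
  simp only [hsNorm_eq_iSup, map_smul, enorm_smul, ENNReal.mul_iSup]

theorem hsNorm_neg (b : HilbertBasis ι ℂ H) (A : H →L[ℂ] H) : hsNorm b (-A) = hsNorm b A := by
  simp only [hsNorm, neg_apply, enorm_neg]

theorem hsNorm_add_le (b : HilbertBasis ι ℂ H) (A B : H →L[ℂ] H) :
    hsNorm b (A + B) ≤ hsNorm b A + hsNorm b B := by
  rw [hsNorm_eq_iSup b (A + B)]
  refine iSup_le fun F => ?_
  rw [map_add]
  exact (enorm_add_le _ _).trans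
    (add_le_add (enorm_basisValues_le b F A) (enorm_basisValues_le b F B))

theorem hsNorm_sub_le (b : HilbertBasis ι ℂ H) (A B : H →L[ℂ] H) :
    hsNorm b (A - B) ≤ hsNorm b A + hsNorm b B := by
  simpa only [sub_eq_add_neg, hsNorm_neg] using hsNorm_add_le b A (-B)

theorem hsNorm_sum_le {α : Type*} (b : HilbertBasis ι ℂ H) (s : Finset α)
    (A : α → H →L[ℂ] H) : hsNorm b (∑ i ∈ s, A i) ≤ ∑ i ∈ s, hsNorm b (A i) :=
  Finset.le_sum_of_subadditive _ (hsNorm_zero b).le (hsNorm_add_le b) s A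

theorem hsNorm_integral_le [CompleteSpace H] {α : Type*} [MeasurableSpace α] {μ : Measure α}
    (b : HilbertBasis ι ℂ H) (A : α → H →L[ℂ] H) :
    hsNorm b (∫ x, A x ∂μ) ≤ ∫⁻ x, hsNorm b (A x) ∂μ := by
  by_cases hA : Integrable A μ
  · rw [hsNorm_eq_iSup]
    refine iSup_le fun F => ?_
    rw [← ContinuousLinearMap.integral_comp_comm (basisValues b F) hA]
    exact (enorm_integral_le_lintegral_enorm _).trans
      (lintegral_mono fun x => enorm_basisValues_le b F (A x))
  · simp only [integral_undef hA, hsNorm_zero, zero_le]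

theorem lowerSemicontinuous_hsNorm (b : HilbertBasis ι ℂ H) :
    LowerSemicontinuous (hsNorm b) := by
  simp only [funext (hsNorm_eq_iSup b)]
  exact lowerSemicontinuous_iSup fun F =>
    (basisValues b F).continuous.enorm.lowerSemicontinuous

theorem hsNorm_adjoint [CompleteSpace H] (b : HilbertBasis ι ℂ H) (A : H →L[ℂ] H) :
    hsNorm b (ContinuousLinearMap.adjoint A) = hsNorm b A := by
  refine (ENNReal.pow_right_strictMono two_ne_zero).injective ?_
  simp only [hsNorm_sq, ← tsum_enorm_inner_sq b]
  rw [ENNReal.tsum_comm]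
  refine tsum_congr fun i => tsum_congr fun j => ?_
  rw [ContinuousLinearMap.adjoint_inner_right, ← inner_conj_symm, RCLike.enorm_conj]

theorem enorm_apply_le_hsNorm [CompleteSpace H] (b : HilbertBasis ι ℂ H) (A : H →L[ℂ] H) (x : H) :
    ‖A x‖ₑ ≤ hsNorm b A * ‖x‖ₑ := by
  rw [← ENNReal.pow_le_pow_left_iff two_ne_zero, ← tsum_enorm_inner_sq b, mul_pow,
    ← hsNorm_adjoint b A, hsNorm_sq, ← ENNReal.tsum_mul_right]
  refine ENNReal.tsum_le_tsum fun j => ?_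
  rw [← ContinuousLinearMap.adjoint_inner_left, ← mul_pow]
  gcongr
  exact enorm_inner_le _ _

theorem enorm_le_hsNorm [CompleteSpace H] (b : HilbertBasis ι ℂ H) (A : H →L[ℂ] H) :
    ‖A‖ₑ ≤ hsNorm b A := by
  by_cases h : hsNorm b A = ∞
  · simp only [h, le_top]
  rw [← ENNReal.ofReal_toReal h, ← ofReal_norm]
  refine ENNReal.ofReal_le_ofReal (A.opNorm_le_bound ENNReal.toReal_nonneg fun x => ?_)
  simpa using ENNReal.toReal_mono (by finiteness) (enorm_apply_le_hsNorm b A x)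

theorem hsNorm_mul_le (b : HilbertBasis ι ℂ H) (A B : H →L[ℂ] H) :
    hsNorm b (A * B) ≤ ‖A‖ₑ * hsNorm b B := by
  rw [← ENNReal.pow_le_pow_left_iff two_ne_zero, mul_pow, hsNorm_sq, hsNorm_sq,
    ← ENNReal.tsum_mul_left]
  refine ENNReal.tsum_le_tsum fun j => ?_
  rw [← mul_pow]
  gcongr
  exact A.le_opENorm (B (b j))

theorem hasSum_norm_apply_sq (b : HilbertBasis ι ℂ H) {A : H →L[ℂ] H} (hA : hsNorm b A < ∞) :
    HasSum (fun j => ‖A (b j)‖ ^ 2) ((hsNorm b A).toReal ^ 2) := by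
  have hfin : ∑' j, ‖A (b j)‖ₑ ^ 2 ≠ ∞ := hsNorm_sq b A ▸ ENNReal.pow_ne_top hA.ne
  have h := ENNReal.hasSum_toReal hfin
  rw [← ENNReal.tsum_toReal_eq fun j => by finiteness, ← hsNorm_sq] at h
  simpa only [ENNReal.toReal_pow, toReal_enorm] using h

theorem hasSum_hsInner (b : HilbertBasis ι ℂ H) {A B : H →L[ℂ] H} (hA : hsNorm b A < ∞)
    (hB : hsNorm b B < ∞) :
    HasSum (fun j => inner ℂ (A (b j)) (B (b j))) (hsInner b A B) :=
  (Summable.of_norm_bounded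
    ((hasSum_norm_apply_sq b hA).add (hasSum_norm_apply_sq b hB)).summable
    fun _ => norm_inner_le_sq_add_sq _ _).hasSum

theorem tsum_enorm_inner_apply_le (b : HilbertBasis ι ℂ H) (A B : H →L[ℂ] H) :
    ∑' j, ‖inner ℂ (A (b j)) (B (b j))‖ₑ ≤ hsNorm b A * hsNorm b B := by
  rw [ENNReal.tsum_eq_iSup_sum]
  refine iSup_le fun F => ?_
  calc ∑ j ∈ F, ‖inner ℂ (A (b j)) (B (b j))‖ₑ
      ≤ ∑ j ∈ F, ‖A (b j)‖ₑ * ‖B (b j)‖ₑ := Finset.sum_le_sum fun j _ => enorm_inner_le _ _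
    _ ≤ (∑ j ∈ F, ‖A (b j)‖ₑ ^ 2) ^ (1 / 2 : ℝ) * (∑ j ∈ F, ‖B (b j)‖ₑ ^ 2) ^ (1 / 2 : ℝ) := by
        simpa only [ENNReal.rpow_two] using ENNReal.inner_le_Lp_mul_Lq F
          (fun j => ‖A (b j)‖ₑ) (fun j => ‖B (b j)‖ₑ) Real.HolderConjugate.two_two
    _ ≤ hsNorm b A * hsNorm b B := by
        unfold hsNorm
        gcongr <;> exact ENNReal.sum_le_tsum F

theorem enorm_hsInner_le (b : HilbertBasis ι ℂ H) (A B : H →L[ℂ] H) :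
    ‖hsInner b A B‖ₑ ≤ hsNorm b A * hsNorm b B :=
  enorm_tsum_le_tsum_enorm.trans (tsum_enorm_inner_apply_le b A B)

end HilbertSchmidt

/-! ### Trace norm -/

section TraceNorm

variable {ι H : Type*} [NormedAddCommGroup H] [InnerProductSpace ℂ H]

/-- The sum of the absolute values of the diagonal entries of an operator. -/
def traceSum (b : HilbertBasis ι ℂ H) (A : H →L[ℂ] H) : ℝ≥0∞ :=
  ∑' j, ‖inner ℂ (b j) (A (b j))‖ₑ

theorem traceSum_add_le (b : HilbertBasis ι ℂ H) (A B : H →L[ℂ] H) :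
    traceSum b (A + B) ≤ traceSum b A + traceSum b B := by
  rw [traceSum, traceSum, traceSum, ← ENNReal.tsum_add]
  refine ENNReal.tsum_le_tsum fun j => ?_
  rw [add_apply, inner_add_right]
  exact enorm_add_le _ _

theorem lowerSemicontinuous_traceSum (b : HilbertBasis ι ℂ H) :
    LowerSemicontinuous (traceSum b) :=
  lowerSemicontinuous_tsum fun j => ((innerSL ℂ (b j)).continuous.comp
    (ContinuousLinearMap.apply ℂ H (b j)).continuous).enorm.lowerSemicontinuous

/-- A seminorm dominating both the Hilbert-Schmidt norm and the trace, and dominated by twice the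
trace norm. It replaces the trace norm wherever subadditivity or measurability is needed, neither
of which is evident from the definition of the trace norm through `|A|`. -/
def hsTraceNorm (b : HilbertBasis ι ℂ H) (A : H →L[ℂ] H) : ℝ≥0∞ := hsNorm b A + traceSum b A

theorem hsNorm_le_hsTraceNorm (b : HilbertBasis ι ℂ H) (A : H →L[ℂ] H) :
    hsNorm b A ≤ hsTraceNorm b A := le_self_add

theorem traceSum_le_hsTraceNorm (b : HilbertBasis ι ℂ H) (A : H →L[ℂ] H) :
    traceSum b A ≤ hsTraceNorm b A := le_add_self

theorem hsTraceNorm_add_le (b : HilbertBasis ι ℂ H) (A B : H →L[ℂ] H) :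
    hsTraceNorm b (A + B) ≤ hsTraceNorm b A + hsTraceNorm b B :=
  (add_le_add (hsNorm_add_le b A B) (traceSum_add_le b A B)).trans_eq (add_add_add_comm _ _ _ _)

theorem aemeasurable_hsTraceNorm {α : Type*} [MeasurableSpace α] {μ : Measure α}
    (b : HilbertBasis ι ℂ H) {A : α → H →L[ℂ] H} (hA : AEStronglyMeasurable A μ) :
    AEMeasurable (fun x => hsTraceNorm b (A x)) μ :=
  ((lowerSemicontinuous_hsNorm b).measurable.add
    (lowerSemicontinuous_traceSum b).measurable).comp_aemeasurable hA.aemeasurable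

theorem norm_apply_le_norm_smul_add {S : H →L[ℂ] H} (hS : 0 ≤ S) {ε : ℝ} (hε : 0 ≤ ε) (y : H) :
    ‖S y‖ ≤ ‖ε • y + S y‖ := by
  have hpos : 0 ≤ RCLike.re (inner ℂ (S y) y) :=
    ((ContinuousLinearMap.nonneg_iff_isPositive S).1 hS).re_inner_nonneg_left y
  refine le_of_sq_le_sq ?_ (norm_nonneg _)
  rw [add_comm, norm_add_sq (𝕜 := ℂ), RCLike.real_smul_eq_coe_smul (K := ℂ) ε y,
    inner_smul_right, RCLike.re_ofReal_mul]
  nlinarith [sq_nonneg ‖((ε : ℝ) : ℂ) • y‖, mul_nonneg hε hpos]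

variable [CompleteSpace H]

/-- The operator `|A|^{1/2}`, whose squared Hilbert-Schmidt norm is the trace norm of `A`. -/
def sqrtAbs (A : H →L[ℂ] H) : H →L[ℂ] H := CFC.sqrt (CFC.abs A)

theorem isSelfAdjoint_sqrtAbs (A : H →L[ℂ] H) : IsSelfAdjoint (sqrtAbs A) :=
  IsSelfAdjoint.of_nonneg (CFC.sqrt_nonneg _)

theorem sqrtAbs_mul_self (A : H →L[ℂ] H) : sqrtAbs A * sqrtAbs A = CFC.abs A :=
  CFC.sqrt_mul_sqrt_self _ (CFC.abs_nonneg A)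

theorem inner_abs_apply_self (A : H →L[ℂ] H) (x : H) :
    inner ℂ (CFC.abs A x) x = ((‖sqrtAbs A x‖ ^ 2 : ℝ) : ℂ) := by
  rw [← sqrtAbs_mul_self, mul_apply_eq_comp]
  nth_rewrite 1 [← (isSelfAdjoint_sqrtAbs A).adjoint_eq]
  rw [ContinuousLinearMap.adjoint_inner_left, inner_self_eq_norm_sq_to_K]
  norm_cast

theorem hsNorm_sqrtAbs_sq (b : HilbertBasis ι ℂ H) (A : H →L[ℂ] H) :
    hsNorm b (sqrtAbs A) ^ 2 = traceNorm b A := by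
  rw [hsNorm_sq, traceNorm]
  refine tsum_congr fun j => ?_
  rw [inner_abs_apply_self, Complex.ofReal_re, ← ofReal_norm, ENNReal.ofReal_pow (norm_nonneg _)]

theorem norm_abs_apply (A : H →L[ℂ] H) (x : H) : ‖CFC.abs A x‖ = ‖A x‖ := by
  have hsa : IsSelfAdjoint (CFC.abs A) := IsSelfAdjoint.of_nonneg (CFC.abs_nonneg A)
  have hcomp : CFC.abs A ∘SL CFC.abs A = star A ∘SL A := CFC.abs_mul_abs A
  have hsq : ‖CFC.abs A x‖ ^ 2 = ‖A x‖ ^ 2 := by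
    rw [ContinuousLinearMap.apply_norm_sq_eq_inner_adjoint_left,
      ContinuousLinearMap.apply_norm_sq_eq_inner_adjoint_left A, hsa.adjoint_eq,
      ← ContinuousLinearMap.star_eq_adjoint, hcomp]
  exact (pow_left_inj₀ (norm_nonneg _) (norm_nonneg _) two_ne_zero).1 hsq

theorem hsNorm_abs (b : HilbertBasis ι ℂ H) (A : H →L[ℂ] H) :
    hsNorm b (CFC.abs A) = hsNorm b A := by
  simp only [hsNorm, ← ofReal_norm, norm_abs_apply]

theorem hsNorm_le_traceNorm (b : HilbertBasis ι ℂ H) (A : H →L[ℂ] H) :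
    hsNorm b A ≤ traceNorm b A := by
  rw [← hsNorm_abs, ← sqrtAbs_mul_self, ← hsNorm_sqrtAbs_sq, sq]
  exact (hsNorm_mul_le b _ _).trans (by gcongr; exact enorm_le_hsNorm b _)

theorem enorm_le_traceNorm (b : HilbertBasis ι ℂ H) (A : H →L[ℂ] H) : ‖A‖ₑ ≤ traceNorm b A :=
  (enorm_le_hsNorm b A).trans (hsNorm_le_traceNorm b A)

theorem isUnit_algebraMap_add_of_nonneg {S : H →L[ℂ] H} (hS : 0 ≤ S) {ε : ℝ} (hε : 0 < ε) :
    IsUnit (algebraMap ℝ (H →L[ℂ] H) ε + S) := by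
  have hns : -ε ∉ spectrum ℝ S := fun h =>
    (neg_lt_zero.2 hε).not_ge (spectrum_nonneg_of_nonneg hS h)
  simpa [add_comm] using (spectrum.notMem_iff.1 hns).neg

/-- An approximate polar decomposition. The contraction is `A (ε + |A|)⁻¹`. -/
theorem exists_norm_sub_mul_abs_le (A : H →L[ℂ] H) {ε : ℝ} (hε : 0 < ε) :
    ∃ U : H →L[ℂ] H, ‖U‖ ≤ 1 ∧ ‖A - U * CFC.abs A‖ ≤ ε := by
  obtain ⟨u, hu⟩ := isUnit_algebraMap_add_of_nonneg (CFC.abs_nonneg A) hε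
  rw [Algebra.algebraMap_eq_smul_one] at hu
  set U : H →L[ℂ] H := A * ↑u⁻¹
  have hU : ‖U‖ ≤ 1 := by
    refine U.opNorm_le_bound zero_le_one fun x => ?_
    set y := (↑u⁻¹ : H →L[ℂ] H) x
    have hx : ε • y + CFC.abs A y = x := by
      rw [show ε • y + CFC.abs A y = (u : H →L[ℂ] H) y by rw [hu]; rfl, ← mul_apply_eq_comp,
        Units.mul_inv, one_apply_eq_self]
    calc ‖A y‖ = ‖CFC.abs A y‖ := (norm_abs_apply A y).symm
      _ ≤ ‖ε • y + CFC.abs A y‖ := norm_apply_le_norm_smul_add (CFC.abs_nonneg A) hε.le y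
      _ = 1 * ‖x‖ := by rw [hx, one_mul]
  have hsub : A - U * CFC.abs A = ε • U := by
    have hUu : U * (ε • 1 + CFC.abs A) = A := by rw [← hu, mul_assoc, Units.inv_mul, mul_one]
    rw [mul_add, mul_smul_comm, mul_one] at hUu
    rw [sub_eq_iff_eq_add, hUu]
  refine ⟨U, hU, ?_⟩
  rw [hsub, norm_smul, Real.norm_of_nonneg hε.le]
  exact mul_le_of_le_one_right hε.le hU

theorem traceSum_mul_abs_le (b : HilbertBasis ι ℂ H) {U : H →L[ℂ] H} (hU : ‖U‖ ≤ 1)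
    (A : H →L[ℂ] H) : traceSum b (U * CFC.abs A) ≤ traceNorm b A := by
  set R := sqrtAbs A
  have hdiag : ∀ x, inner ℂ x ((U * CFC.abs A) x) =
      inner ℂ (ContinuousLinearMap.adjoint (U * R) x) (R x) := fun x => by
    rw [ContinuousLinearMap.adjoint_inner_left, ← mul_apply_eq_comp, mul_assoc, sqrtAbs_mul_self]
  have hUR : hsNorm b (U * R) ≤ hsNorm b R :=
    (hsNorm_mul_le b U R).trans (mul_le_of_le_one_left' (by simpa [← ofReal_norm] using hU))
  simp only [traceSum, hdiag]
  calc ∑' j, ‖inner ℂ (ContinuousLinearMap.adjoint (U * R) (b j)) (R (b j))‖ₑ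
      ≤ hsNorm b (ContinuousLinearMap.adjoint (U * R)) * hsNorm b R :=
        tsum_enorm_inner_apply_le b _ _
    _ ≤ hsNorm b R * hsNorm b R := by
        rw [hsNorm_adjoint]
        gcongr
    _ = traceNorm b A := by rw [← sq, hsNorm_sqrtAbs_sq]

theorem traceSum_le_traceNorm (b : HilbertBasis ι ℂ H) (A : H →L[ℂ] H) :
    traceSum b A ≤ traceNorm b A := by
  have hclosed : IsClosed {B : H →L[ℂ] H | traceSum b B ≤ traceNorm b A} :=
    (lowerSemicontinuous_traceSum b).isClosed_preimage _
  refine hclosed.closure_subset (Metric.mem_closure_iff.2 fun ε hε => ?_)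
  obtain ⟨U, hU, hAU⟩ := exists_norm_sub_mul_abs_le A (half_pos hε)
  refine ⟨U * CFC.abs A, traceSum_mul_abs_le b hU A, ?_⟩
  rw [dist_eq_norm]
  exact hAU.trans_lt (half_lt_self hε)

theorem hsTraceNorm_le (b : HilbertBasis ι ℂ H) (A : H →L[ℂ] H) :
    hsTraceNorm b A ≤ 2 * traceNorm b A :=
  two_mul (traceNorm b A) ▸ add_le_add (hsNorm_le_traceNorm b A) (traceSum_le_traceNorm b A)

end TraceNorm

/-! ### Moments of random operators -/

section Moments

variable {ι H Ω : Type*} [NormedAddCommGroup H] [InnerProductSpace ℂ H]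
  [MeasurableSpace Ω] {P : Measure Ω}

theorem outer_apply (x y z : H) : outer x y z = inner ℂ y z • x := rfl

theorem hsNorm_outer (b : HilbertBasis ι ℂ H) (x y : H) :
    hsNorm b (outer x y) = ‖x‖ₑ * ‖y‖ₑ := by
  refine (ENNReal.pow_right_strictMono two_ne_zero).injective ?_
  rw [hsNorm_sq, mul_pow, ← tsum_enorm_inner_sq b y, ← ENNReal.tsum_mul_left]
  refine tsum_congr fun j => ?_
  rw [outer_apply, enorm_smul, ← inner_conj_symm, RCLike.enorm_conj, mul_pow, mul_comm]

theorem hsNorm_outer_lt_top (b : HilbertBasis ι ℂ H) (x y : H) : hsNorm b (outer x y) < ∞ := by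
  rw [hsNorm_outer]
  finiteness

theorem hasSum_norm_outer_sq (b : HilbertBasis ι ℂ H) (x y : H) :
    HasSum (fun j => ‖outer x y (b j)‖ ^ 2) ((‖x‖ * ‖y‖) ^ 2) := by
  simpa only [hsNorm_outer, ENNReal.toReal_mul, toReal_enorm] using
    hasSum_norm_apply_sq b (hsNorm_outer_lt_top b x y)

theorem continuous_outer : Continuous fun p : H × H => outer p.1 p.2 :=
  (isBoundedBilinearMap_smulRight (𝕜 := ℂ) (E := H) (F := H)).continuous.comp
    (((innerSL ℂ).continuous.comp continuous_snd).prodMk continuous_fst)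

theorem aestronglyMeasurable_outer {Y Z : Ω → H} (hY : AEStronglyMeasurable Y P)
    (hZ : AEStronglyMeasurable Z P) : AEStronglyMeasurable (fun ω => outer (Y ω) (Z ω)) P :=
  Continuous.comp_aestronglyMeasurable (g := fun p : H × H => outer p.1 p.2)
    (f := fun ω => (Y ω, Z ω)) continuous_outer (hY.prodMk hZ)

theorem integrable_outer {Y Z : Ω → H} (hY : MemLp Y 2 P) (hZ : MemLp Z 2 P) :
    Integrable (fun ω => outer (Y ω) (Z ω)) P := by
  refine (hY.norm.integrable_mul hZ.norm).mono (aestronglyMeasurable_outer hY.1 hZ.1)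
    (Eventually.of_forall fun ω => ?_)
  simp only [outer, InnerProductSpace.norm_rankOne, Pi.mul_apply, norm_mul, norm_norm, le_refl]

theorem integrable_inner {Y Z : Ω → H} (hY : MemLp Y 2 P) (hZ : MemLp Z 2 P) :
    Integrable (fun ω => inner ℂ (Y ω) (Z ω)) P := by
  refine (hY.norm.integrable_mul hZ.norm).mono (hY.1.inner hZ.1) (Eventually.of_forall fun ω => ?_)
  simpa only [Pi.mul_apply, norm_mul, norm_norm] using norm_inner_le_norm (𝕜 := ℂ) (Y ω) (Z ω)

theorem holderTriple_four_four_two : ENNReal.HolderTriple 4 4 2 where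
  inv_add_inv_eq_inv := by
    rw [← two_mul, show (4 : ℝ≥0∞) = 2 * 2 by norm_num, ENNReal.mul_inv (by simp) (by simp),
      ← mul_assoc, ENNReal.mul_inv_cancel (by simp) (by simp), one_mul]

theorem memLp_outer_apply {Y Z : Ω → H} (hY : MemLp Y 4 P) (hZ : MemLp Z 4 P) (x : H) :
    MemLp (fun ω => outer (Y ω) (Z ω) x) 2 P :=
  have := holderTriple_four_four_two
  hY.smul (hZ.inner_const (𝕜 := ℂ) x)

theorem hasSum_integral_inner_outer [Countable ι] (b : HilbertBasis ι ℂ H) {Y₁ Y₂ Y₃ Y₄ : Ω → H}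
    (h₁ : MemLp Y₁ 4 P) (h₂ : MemLp Y₂ 4 P) (h₃ : MemLp Y₃ 4 P) (h₄ : MemLp Y₄ 4 P) :
    HasSum (fun j => ∫ ω, inner ℂ (outer (Y₁ ω) (Y₂ ω) (b j)) (outer (Y₃ ω) (Y₄ ω) (b j)) ∂P)
      (∫ ω, hsInner b (outer (Y₁ ω) (Y₂ ω)) (outer (Y₃ ω) (Y₄ ω)) ∂P) := by
  have hsum : ∀ ω, HasSum (fun j => ‖outer (Y₁ ω) (Y₂ ω) (b j)‖ ^ 2 +
      ‖outer (Y₃ ω) (Y₄ ω) (b j)‖ ^ 2) ((‖Y₁ ω‖ * ‖Y₂ ω‖) ^ 2 + (‖Y₃ ω‖ * ‖Y₄ ω‖) ^ 2) :=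
    fun ω => (hasSum_norm_outer_sq b _ _).add (hasSum_norm_outer_sq b _ _)
  refine hasSum_integral_of_dominated_convergence
    (fun j ω => ‖outer (Y₁ ω) (Y₂ ω) (b j)‖ ^ 2 + ‖outer (Y₃ ω) (Y₄ ω) (b j)‖ ^ 2)
    (fun j => (memLp_outer_apply h₁ h₂ _).1.inner (memLp_outer_apply h₃ h₄ _).1)
    (fun j => Eventually.of_forall fun ω => norm_inner_le_sq_add_sq _ _)
    (Eventually.of_forall fun ω => (hsum ω).summable) ?_
    (Eventually.of_forall fun ω =>
      hasSum_hsInner b (hsNorm_outer_lt_top b _ _) (hsNorm_outer_lt_top b _ _))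
  have := holderTriple_four_four_two
  have h₁₂ : MemLp (fun ω => ‖Y₁ ω‖ * ‖Y₂ ω‖) 2 P := h₂.norm.mul h₁.norm
  have h₃₄ : MemLp (fun ω => ‖Y₃ ω‖ * ‖Y₄ ω‖) 2 P := h₄.norm.mul h₃.norm
  simp only [(hsum _).tsum_eq]
  exact h₁₂.integrable_sq.add h₃₄.integrable_sq

theorem hasSum_integral_inner_mul_inner [Countable ι] (b : HilbertBasis ι ℂ H) {Y Z : Ω → H}
    (hY : MemLp Y 2 P) (hZ : MemLp Z 2 P) :
    HasSum (fun j => ∫ ω, inner ℂ (Y ω) (b j) * inner ℂ (b j) (Z ω) ∂P)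
      (∫ ω, inner ℂ (Y ω) (Z ω) ∂P) := by
  have hsum : ∀ ω, HasSum (fun j => ‖inner ℂ (b j) (Y ω)‖ ^ 2 + ‖inner ℂ (b j) (Z ω)‖ ^ 2)
      (‖Y ω‖ ^ 2 + ‖Z ω‖ ^ 2) := fun ω =>
    (hasSum_norm_inner_sq b _).add (hasSum_norm_inner_sq b _)
  refine hasSum_integral_of_dominated_convergence
    (fun j ω => ‖inner ℂ (b j) (Y ω)‖ ^ 2 + ‖inner ℂ (b j) (Z ω)‖ ^ 2)
    (fun j => (hY.inner_const (b j)).1.mul (hZ.const_inner (b j)).1)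
    (fun j => Eventually.of_forall fun ω => ?_)
    (Eventually.of_forall fun ω => (hsum ω).summable) ?_
    (Eventually.of_forall fun ω => b.hasSum_inner_mul_inner _ _)
  · rw [norm_mul, norm_inner_symm]
    nlinarith [sq_nonneg (‖inner ℂ (b j) (Y ω)‖ - ‖inner ℂ (b j) (Z ω)‖)]
  · simp only [(hsum _).tsum_eq]
    exact hY.norm.integrable_sq.add hZ.norm.integrable_sq

theorem covOp_apply {Y Z : Ω → H} (hY : MemLp Y 2 P) (hZ : MemLp Z 2 P) (x : H) :
    covOp P Y Z x = ∫ ω, outer (Y ω) (Z ω) x ∂P := by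
  rw [covOp, ContinuousLinearMap.integral_apply (integrable_outer hY hZ)]

theorem lintegral_hsNorm_sq [Countable ι] (b : HilbertBasis ι ℂ H) {A : Ω → H →L[ℂ] H}
    (hA : ∀ j, MemLp (fun ω => A ω (b j)) 2 P) :
    ∫⁻ ω, hsNorm b (A ω) ^ 2 ∂P = ∑' j, ENNReal.ofReal (∫ ω, ‖A ω (b j)‖ ^ 2 ∂P) := by
  simp only [hsNorm_sq]
  rw [lintegral_tsum fun j => (hA j).1.enorm.pow_const 2]
  refine tsum_congr fun j => ?_
  rw [ofReal_integral_eq_lintegral_ofReal (hA j).norm.integrable_sq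
    (Eventually.of_forall fun ω => by positivity)]
  simp only [ENNReal.ofReal_pow (norm_nonneg _), ofReal_norm]

theorem covOp_congr_right (Y : Ω → H) {Z Z' : Ω → H} (hZ : ∀ᵐ ω ∂P, Z ω = Z' ω) :
    covOp P Y Z = covOp P Y Z' :=
  integral_congr_ae (hZ.mono fun ω hω => by simp only [hω])

theorem integral_norm_sq_sum_smul {α : Type*} [Fintype α] (w : α → ℂ) {η : α → Ω → H}
    (hη : ∀ a, MemLp (η a) 2 P) :
    ((∫ ω, ‖∑ a, w a • η a ω‖ ^ 2 ∂P : ℝ) : ℂ) =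
      ∑ a, ∑ c, starRingEnd ℂ (w a) * w c * ∫ ω, inner ℂ (η a ω) (η c ω) ∂P := by
  have hexpand : ∀ ω, ((‖∑ a, w a • η a ω‖ ^ 2 : ℝ) : ℂ) =
      ∑ a, ∑ c, starRingEnd ℂ (w a) * w c * inner ℂ (η a ω) (η c ω) := fun ω => by
    rw [Complex.ofReal_pow]
    refine (inner_self_eq_norm_sq_to_K (𝕜 := ℂ) (∑ a, w a • η a ω)).symm.trans ?_
    simp only [sum_inner, inner_sum (𝕜 := ℂ) _ _ (w _ • η _ ω), inner_smul_left, inner_smul_right,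
      mul_assoc, mul_left_comm]
  have hint : ∀ a c, Integrable (fun ω => starRingEnd ℂ (w a) * w c * inner ℂ (η a ω) (η c ω)) P :=
    fun a c => (integrable_inner (hη a) (hη c)).const_mul _
  rw [← integral_complex_ofReal]
  simp only [hexpand]
  rw [integral_finsetSum _ fun a _ => integrable_finsetSum _ fun c _ => hint a c]
  simp only [integral_finsetSum _ fun c _ => hint _ c, integral_const_mul]

variable [CompleteSpace H]

theorem inner_covOp_apply {Y Z : Ω → H} (hY : MemLp Y 2 P) (hZ : MemLp Z 2 P) (x y : H) :
    inner ℂ x (covOp P Y Z y) = ∫ ω, inner ℂ (Z ω) y * inner ℂ x (Y ω) ∂P := by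
  rw [covOp_apply hY hZ, ← integral_inner]
  · simp only [outer_apply, inner_smul_right]
  · exact (ContinuousLinearMap.apply ℂ H y).integrable_comp (integrable_outer hY hZ)

theorem hsNorm_covOp_lt_top (b : HilbertBasis ι ℂ H) {Y Z : Ω → H} (hY : MemLp Y 2 P)
    (hZ : MemLp Z 2 P) : hsNorm b (covOp P Y Z) < ∞ := by
  refine (hsNorm_integral_le b _).trans_lt ?_
  simpa only [HasFiniteIntegral, hsNorm_outer, Pi.mul_apply, enorm_mul, enorm_norm] using
    (hY.norm.integrable_mul hZ.norm).2

theorem enorm_integral_inner_le_traceSum [Countable ι] (b : HilbertBasis ι ℂ H) {Y Z : Ω → H}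
    (hY : MemLp Y 2 P) (hZ : MemLp Z 2 P) :
    ‖∫ ω, inner ℂ (Y ω) (Z ω) ∂P‖ₑ ≤ traceSum b (covOp P Z Y) := by
  rw [← (hasSum_integral_inner_mul_inner b hY hZ).tsum_eq, traceSum]
  simp only [inner_covOp_apply hZ hY]
  exact enorm_tsum_le_tsum_enorm

theorem integral_inner_sub_integral [IsProbabilityMeasure P] {Y Z : Ω → H}
    (hY : MemLp Y 2 P) (hZ : MemLp Z 2 P) :
    ∫ ω, inner ℂ (Y ω - ∫ ω', Y ω' ∂P) (Z ω - ∫ ω', Z ω' ∂P) ∂P =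
      (∫ ω, inner ℂ (Y ω) (Z ω) ∂P) - inner ℂ (∫ ω, Y ω ∂P) (∫ ω, Z ω ∂P) := by
  set m := ∫ ω, Y ω ∂P with hm
  set m' := ∫ ω, Z ω ∂P with hm'
  have hYi : Integrable Y P := hY.integrable one_le_two
  have hZi : Integrable Z P := hZ.integrable one_le_two
  have hZm : Integrable (fun ω => Z ω - m') P := hZi.sub (integrable_const _)
  have hcentred : ∫ ω, inner ℂ m (Z ω - m') ∂P = 0 := by
    rw [integral_inner hZm, integral_sub hZi (integrable_const _), integral_const, probReal_univ,
      one_smul, ← hm', sub_self, inner_zero_right]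
  have hright : ∫ ω, inner ℂ (Y ω) m' ∂P = inner ℂ m m' := by
    simp only [← inner_conj_symm _ m', integral_conj, integral_inner hYi, hm]
  have hYZm : Integrable (fun ω => inner ℂ (Y ω) (Z ω - m')) P := by
    simp only [inner_sub_right]
    exact (integrable_inner hY hZ).sub (hYi.inner_const m')
  calc ∫ ω, inner ℂ (Y ω - m) (Z ω - m') ∂P
      = ∫ ω, inner ℂ (Y ω) (Z ω - m') ∂P := by
        simp only [inner_sub_left _ m, integral_sub hYZm (hZm.const_inner m), hcentred, sub_zero]
    _ = _ := by
        simp only [inner_sub_right, integral_sub (integrable_inner hY hZ) (hYi.inner_const m'),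
          hright]

/-- The covariance, in the Hilbert-Schmidt inner product, of `Y₁ ⊗ Y₂` and `Y₃ ⊗ Y₄`. -/
def outerCov (b : HilbertBasis ι ℂ H) (P : Measure Ω) (Y₁ Y₂ Y₃ Y₄ : Ω → H) : ℂ :=
  (∫ ω, hsInner b (outer (Y₁ ω) (Y₂ ω)) (outer (Y₃ ω) (Y₄ ω)) ∂P)
    - hsInner b (covOp P Y₁ Y₂) (covOp P Y₃ Y₄)

theorem hasSum_integral_norm_sq_sum_sub_covOp [Countable ι] [IsProbabilityMeasure P]
    (b : HilbertBasis ι ℂ H) {α : Type*} [Fintype α] (w : α → ℂ) {Y Z : α → Ω → H}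
    (hY : ∀ a, MemLp (Y a) 4 P) (hZ : ∀ a, MemLp (Z a) 4 P) :
    HasSum (fun j => ((∫ ω, ‖∑ a, w a •
        (outer (Y a ω) (Z a ω) (b j) - covOp P (Y a) (Z a) (b j))‖ ^ 2 ∂P : ℝ) : ℂ))
      (∑ a, ∑ c, starRingEnd ℂ (w a) * w c * outerCov b P (Y a) (Z a) (Y c) (Z c)) := by
  have hY2 : ∀ a, MemLp (Y a) 2 P := fun a => (hY a).mono_exponent (by norm_num)
  have hZ2 : ∀ a, MemLp (Z a) 2 P := fun a => (hZ a).mono_exponent (by norm_num)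
  have hξ : ∀ j a, MemLp (fun ω => outer (Y a ω) (Z a ω) (b j)) 2 P := fun j a =>
    memLp_outer_apply (hY a) (hZ a) _
  have hη : ∀ j a, MemLp (fun ω => outer (Y a ω) (Z a ω) (b j)
      - ∫ ω', outer (Y a ω') (Z a ω') (b j) ∂P) 2 P := fun j a => (hξ j a).sub (memLp_const _)
  simp only [covOp_apply (hY2 _) (hZ2 _), integral_norm_sq_sum_smul w (hη _),
    integral_inner_sub_integral (hξ _ _) (hξ _ _)]
  refine hasSum_sum fun a _ => hasSum_sum fun c _ => HasSum.mul_left _ (HasSum.sub ?_ ?_)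
  · exact hasSum_integral_inner_outer b (hY a) (hZ a) (hY c) (hZ c)
  · simpa only [covOp_apply (hY2 _) (hZ2 _)] using
      hasSum_hsInner b (hsNorm_covOp_lt_top b (hY2 a) (hZ2 a))
        (hsNorm_covOp_lt_top b (hY2 c) (hZ2 c))

theorem lintegral_hsNorm_sum_sub_covOp_sq_le [Countable ι] [IsProbabilityMeasure P]
    (b : HilbertBasis ι ℂ H) {α : Type*} [Fintype α] (w : α → ℂ) {Y Z : α → Ω → H}
    (hY : ∀ a, MemLp (Y a) 4 P) (hZ : ∀ a, MemLp (Z a) 4 P) :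
    ∫⁻ ω, hsNorm b (∑ a, w a • (outer (Y a ω) (Z a ω) - covOp P (Y a) (Z a))) ^ 2 ∂P ≤
      ∑ a, ∑ c, ‖w a‖ₑ * ‖w c‖ₑ * ‖outerCov b P (Y a) (Z a) (Y c) (Z c)‖ₑ := by
  have hsum := (hasSum_integral_norm_sq_sum_sub_covOp b w hY hZ).mapL Complex.reCLM
  simp only [Complex.reCLM_apply, Complex.ofReal_re] at hsum
  have hmem : ∀ j, MemLp (fun ω => (∑ a, w a •
      (outer (Y a ω) (Z a ω) - covOp P (Y a) (Z a))) (b j)) 2 P := fun j => by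
    simp only [sum_apply, smul_apply, sub_apply]
    exact memLp_finsetSum _ fun a _ =>
      ((memLp_outer_apply (hY a) (hZ a) _).sub (memLp_const _)).const_smul _
  rw [lintegral_hsNorm_sq b hmem]
  simp only [sum_apply, smul_apply, sub_apply]
  rw [← ENNReal.ofReal_tsum_of_nonneg (fun j => integral_nonneg fun ω => by positivity)
    hsum.summable, hsum.tsum_eq]
  refine (ENNReal.ofReal_le_ofReal (Complex.re_le_norm _)).trans ?_
  rw [ofReal_norm]
  refine (enorm_sum_le _ _).trans (Finset.sum_le_sum fun a _ =>
    (enorm_sum_le _ _).trans (Finset.sum_le_sum fun c _ => ?_))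
  rw [enorm_mul, enorm_mul, RCLike.enorm_conj]

theorem enorm_outerCov_le [Countable ι] (b : HilbertBasis ι ℂ H) {Y₁ Y₂ Y₃ Y₄ : Ω → H}
    (h₁ : MemLp Y₁ 2 P) (h₂ : MemLp Y₂ 2 P) (h₃ : MemLp Y₃ 2 P) (h₄ : MemLp Y₄ 2 P)
    (hr₂ : ∀ᵐ ω ∂P, conj b (Y₂ ω) = Y₂ ω) (hr₄ : ∀ᵐ ω ∂P, conj b (Y₄ ω) = Y₄ ω) :
    ‖outerCov b P Y₁ Y₂ Y₃ Y₄‖ₑ ≤ ‖cum b P Y₁ Y₂ Y₃ Y₄‖ₑ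
      + hsTraceNorm b (covOp P Y₃ Y₁) * hsTraceNorm b (covOp P Y₂ Y₄)
      + hsTraceNorm b (covOp P Y₁ Y₄) * hsTraceNorm b (covOp P Y₃ Y₂) := by
  have h : outerCov b P Y₁ Y₂ Y₃ Y₄ = cum b P Y₁ Y₂ Y₃ Y₄
      + (∫ ω, inner ℂ (Y₁ ω) (Y₃ ω) ∂P) * (∫ ω, inner ℂ (Y₄ ω) (Y₂ ω) ∂P)
      + hsInner b (covOp P Y₁ Y₄) (covOp P Y₃ Y₂) := by
    rw [cum, covOp_congr_right Y₁ hr₄, covOp_congr_right Y₃ hr₂, outerCov]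
    ring
  rw [h]
  refine enorm_add₃_le.trans (add_le_add (add_le_add le_rfl ?_) ?_)
  · rw [enorm_mul]
    exact mul_le_mul'
      ((enorm_integral_inner_le_traceSum b h₁ h₃).trans (traceSum_le_hsTraceNorm b _))
      ((enorm_integral_inner_le_traceSum b h₄ h₂).trans (traceSum_le_hsTraceNorm b _))
  · exact (enorm_hsInner_le b _ _).trans
      (mul_le_mul' (hsNorm_le_hsTraceNorm b _) (hsNorm_le_hsTraceNorm b _))

end Moments

/-! ### Voronoi cells -/

section Cells

variable {d n : ℕ} (t : Fin n → EuclideanSpace ℝ (Fin d))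

theorem region_eq_convexHull : region t = convexHull ℝ (Set.range t) :=
  ((Set.finite_range t).isCompact_convexHull ℝ).isClosed.closure_eq

theorem isCompact_region : IsCompact (region t) := by
  rw [region_eq_convexHull]
  exact (Set.finite_range t).isCompact_convexHull ℝ

theorem convex_region : Convex ℝ (region t) := by
  rw [region_eq_convexHull]
  exact convex_convexHull ℝ _

theorem measurableSet_region : MeasurableSet (region t) := (isCompact_region t).measurableSet

theorem cell_subset_region (i : Fin n) : cell t i ⊆ region t := fun _ hx => hx.1

theorem measurableSet_cell (i : Fin n) : MeasurableSet (cell t i) := by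
  have h : cell t i = region t ∩ ⋂ j, {x | ‖x - t i‖ ≤ ‖x - t j‖} := by
    ext x
    simp only [cell, Set.mem_ofPred_eq, Set.mem_inter_iff, Set.mem_iInter]
  rw [h]
  exact (measurableSet_region t).inter (MeasurableSet.iInter fun j =>
    (isClosed_le (by fun_prop) (by fun_prop)).measurableSet)

theorem volume_cell_lt_top (i : Fin n) : volume (cell t i) < ∞ :=
  (measure_mono (cell_subset_region t i)).trans_lt (isCompact_region t).measure_lt_top

theorem norm_sub_le_tessDiam {i : Fin n} {x : EuclideanSpace ℝ (Fin d)} (hx : x ∈ cell t i) :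
    ‖x - t i‖ ≤ tessDiam t := by
  have hbdd : BddAbove (Set.range fun y : cell t i => ‖(y : EuclideanSpace ℝ (Fin d)) - t i‖) := by
    obtain ⟨R, hR⟩ := (isCompact_region t).isBounded.subset_closedBall (t i)
    refine ⟨R, ?_⟩
    rintro _ ⟨y, rfl⟩
    exact mem_closedBall_iff_norm.1 (hR (cell_subset_region t i y.2))
  exact le_ciSup_of_le (Set.finite_range _).bddAbove i (le_ciSup hbdd ⟨x, hx⟩)

theorem tessDiam_nonneg : 0 ≤ tessDiam t :=
  Real.iSup_nonneg fun _ => Real.iSup_nonneg fun _ => norm_nonneg _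

theorem exists_mem_cell {x : EuclideanSpace ℝ (Fin d)} (hx : x ∈ region t) :
    ∃ i, x ∈ cell t i := by
  have : Nonempty (Fin n) := by
    rw [region_eq_convexHull] at hx
    exact Set.range_nonempty_iff_nonempty.1 (convexHull_nonempty_iff.1 ⟨x, hx⟩)
  obtain ⟨i, hi⟩ := Finite.exists_min fun j => ‖x - t j‖
  exact ⟨i, hx, hi⟩

theorem volume_cell_inter_cell {i j : Fin n} (hij : t i ≠ t j) :
    volume (cell t i ∩ cell t j) = 0 := by
  refine measure_mono_null (t := (AffineSubspace.perpBisector (t i) (t j) : Set _)) ?_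
    (Measure.addHaar_affineSubspace volume _ (by simpa using hij))
  rintro x ⟨hi, hj⟩
  rw [SetLike.mem_coe, AffineSubspace.mem_perpBisector_iff_dist_eq, dist_eq_norm, dist_eq_norm]
  exact le_antisymm (hi.2 j) (hj.2 i)

/-- Voronoi cells with ties broken in favour of the smallest index, so that they are pairwise
disjoint. -/
def disjointCell (i : Fin n) : Set (EuclideanSpace ℝ (Fin d)) := disjointed (cell t) i

theorem disjointCell_subset_cell (i : Fin n) : disjointCell t i ⊆ cell t i :=
  disjointed_subset (cell t) i

theorem measurableSet_disjointCell (i : Fin n) : MeasurableSet (disjointCell t i) :=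
  disjointedRec (fun _ j ht => ht.diff (measurableSet_cell t j)) (measurableSet_cell t i)

theorem pairwise_disjoint_disjointCell : Pairwise (Function.onFun Disjoint (disjointCell t)) :=
  disjoint_disjointed (cell t)

theorem iUnion_disjointCell : ⋃ i, disjointCell t i = region t := by
  rw [show ⋃ i, disjointCell t i = ⋃ i, cell t i from iUnion_disjointed]
  exact Set.Subset.antisymm (Set.iUnion_subset (cell_subset_region t))
    fun x hx => Set.mem_iUnion.2 (exists_mem_cell t hx)

theorem volume_disjointCell (ht : Function.Injective t) (i : Fin n) :
    volume (disjointCell t i) = volume (cell t i) := by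
  refine measure_eq_measure_of_null_sdiff (disjointCell_subset_cell t i) ?_
  refine measure_mono_null (t := ⋃ j ∈ Set.Iio i, cell t i ∩ cell t j) ?_
    ((measure_biUnion_null_iff (Set.to_countable _)).2 fun j hj =>
      volume_cell_inter_cell t fun h => (ne_of_lt hj) (ht h).symm)
  rintro x ⟨hx, hx'⟩
  simp only [disjointCell, disjointed_eq_inter_compl, Set.mem_inter_iff, hx, true_and,
    Set.mem_iInter, Set.mem_compl_iff, not_forall, not_not] at hx'
  obtain ⟨j, hj, hxj⟩ := hx'
  exact Set.mem_biUnion hj ⟨hx, hxj⟩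

end Cells

/-! ### Overlap of a convex body with its translates -/

section Overlap

variable {E : Type*} [NormedAddCommGroup E] [NormedSpace ℝ E]

/-- The homothetic image `x₀ + (1 - ε) (R - x₀)` is contained in `R` and in `R - k`, because
`x₀ + k / ε` belongs to `R`. -/
theorem homothety_image_subset_inter_preimage_add {R : Set E} (hconv : Convex ℝ R) {x₀ k : E}
    {ε : ℝ} (hε : 0 < ε) (hε1 : ε ≤ 1) (hx₀ : x₀ ∈ R) (hk : x₀ + ε⁻¹ • k ∈ R) :
    AffineMap.homothety x₀ (1 - ε) '' R ⊆ R ∩ (fun x => x + k) ⁻¹' R := by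
  rintro _ ⟨x, hx, rfl⟩
  have hcomb : AffineMap.homothety x₀ (1 - ε) x = (1 - ε) • x + ε • x₀ := by
    rw [AffineMap.homothety_apply, vsub_eq_sub, vadd_eq_add]
    module
  have hshift : (1 - ε) • x + ε • x₀ + k = (1 - ε) • x + ε • (x₀ + ε⁻¹ • k) := by
    rw [smul_add, smul_inv_smul₀ hε.ne', add_assoc]
  rw [hcomb]
  refine ⟨hconv hx hx₀ (sub_nonneg.2 hε1) hε.le (sub_add_cancel 1 ε), ?_⟩
  rw [Set.mem_preimage, hshift]
  exact hconv hx hk (sub_nonneg.2 hε1) hε.le (sub_add_cancel 1 ε)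

theorem add_smul_mem_closedBall (x₀ : E) {k : E} (hk : k ≠ 0) {ρ : ℝ} (hρ : 0 < ρ) :
    x₀ + (‖k‖ / ρ)⁻¹ • k ∈ Metric.closedBall x₀ ρ := by
  rw [mem_closedBall_iff_norm, add_sub_cancel_left, norm_smul, inv_div, norm_div, norm_norm,
    Real.norm_of_nonneg hρ.le]
  exact (div_mul_cancel₀ ρ (norm_ne_zero_iff.2 hk)).le

variable [FiniteDimensional ℝ E] [MeasurableSpace E] [BorelSpace E] (μ : Measure E)
  [μ.IsAddHaarMeasure] {R : Set E}

theorem measureReal_diff_preimage_add_le (hR : IsCompact R) (hconv : Convex ℝ R) {x₀ : E} {ρ : ℝ}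
    (hρ : 0 < ρ) (hball : Metric.closedBall x₀ ρ ⊆ R) (k : E) :
    μ.real (R \ (fun x => x + k) ⁻¹' R) ≤ Module.finrank ℝ E * (‖k‖ / ρ) * μ.real R := by
  rcases eq_or_ne k 0 with rfl | hk
  · simp
  have hfin : μ R ≠ ∞ := hR.measure_lt_top.ne
  have hεpos : 0 < ‖k‖ / ρ := div_pos (norm_pos_iff.2 hk) hρ
  set ε := ‖k‖ / ρ
  rcases le_total 1 ε with hε1 | hε1
  · have hdim : (1 : ℝ) ≤ Module.finrank ℝ E := by
      have : Nontrivial E := ⟨k, 0, hk⟩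
      exact_mod_cast Module.finrank_pos (R := ℝ) (M := E)
    calc μ.real (R \ (fun x => x + k) ⁻¹' R) ≤ μ.real R := measureReal_mono Set.sdiff_subset hfin
      _ ≤ Module.finrank ℝ E * ε * μ.real R :=
          le_mul_of_one_le_left measureReal_nonneg (one_le_mul_of_one_le_of_one_le hdim hε1)
  have hx₀ : x₀ ∈ R := hball (Metric.mem_closedBall_self hρ.le)
  have hvol : μ.real (AffineMap.homothety x₀ (1 - ε) '' R) =
      (1 - ε) ^ Module.finrank ℝ E * μ.real R := by
    have hnonneg : 0 ≤ (1 - ε) ^ Module.finrank ℝ E := pow_nonneg (sub_nonneg.2 hε1) _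
    rw [measureReal_def, Measure.addHaar_image_homothety, abs_of_nonneg hnonneg,
      ENNReal.toReal_mul, ENNReal.toReal_ofReal hnonneg, measureReal_def]
  have hle : (1 - ε) ^ Module.finrank ℝ E * μ.real R ≤ μ.real (R ∩ (fun x => x + k) ⁻¹' R) :=
    hvol ▸ measureReal_mono
      (homothety_image_subset_inter_preimage_add hconv hεpos hε1 hx₀
        (hball (add_smul_mem_closedBall x₀ hk hρ)))
      (measure_ne_top_of_subset Set.inter_subset_left hfin)
  have hsplit := measureReal_inter_add_sdiff (μ := μ) (s := R)
    (measurable_add_const k hR.measurableSet) hfin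
  have hbernoulli : 1 + Module.finrank ℝ E * -ε ≤ (1 - ε) ^ Module.finrank ℝ E := by
    simpa only [sub_eq_add_neg] using one_add_mul_le_pow (a := -ε) (by linarith) _
  nlinarith [mul_le_mul_of_nonneg_right hbernoulli (measureReal_nonneg (μ := μ) (s := R))]

theorem measureReal_inter_preimage_add_sub_le (hR : IsCompact R) (hconv : Convex ℝ R) {x₀ : E}
    {ρ : ℝ} (hρ : 0 < ρ) (hball : Metric.closedBall x₀ ρ ⊆ R) (h h' : E) :
    μ.real (R ∩ (fun x => x + h) ⁻¹' R) - μ.real (R ∩ (fun x => x + h') ⁻¹' R)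
      ≤ Module.finrank ℝ E * (‖h - h'‖ / ρ) * μ.real R := by
  have hfin : μ R ≠ ∞ := hR.measure_lt_top.ne
  set D := R \ (fun x => x + (h' - h)) ⁻¹' R
  have hsub : R ∩ (fun x => x + h) ⁻¹' R ⊆
      (R ∩ (fun x => x + h') ⁻¹' R) ∪ (fun x => x + h) ⁻¹' D := by
    rintro x ⟨hx, hxh⟩
    by_cases hx' : x + h' ∈ R
    · exact Or.inl ⟨hx, hx'⟩
    · exact Or.inr ⟨hxh, fun hmem => hx' (by simpa [add_assoc] using hmem)⟩
  have hDfin : μ ((fun x => x + h) ⁻¹' D) ≠ ∞ := by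
    rw [measure_preimage_add_right]
    exact measure_ne_top_of_subset Set.sdiff_subset hfin
  rw [sub_le_iff_le_add']
  calc μ.real (R ∩ (fun x => x + h) ⁻¹' R)
      ≤ μ.real (R ∩ (fun x => x + h') ⁻¹' R) + μ.real ((fun x => x + h) ⁻¹' D) :=
        (measureReal_mono hsub (measure_union_ne_top
          (measure_ne_top_of_subset Set.inter_subset_left hfin) hDfin)).trans
          (measureReal_union_le _ _)
    _ = μ.real (R ∩ (fun x => x + h') ⁻¹' R) + μ.real D := by
        rw [measureReal_def μ (_ ⁻¹' D), measure_preimage_add_right, ← measureReal_def]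
    _ ≤ _ := by
        gcongr
        rw [norm_sub_rev]
        exact measureReal_diff_preimage_add_le μ hR hconv hρ hball (h' - h)

end Overlap

theorem image_sub_eq_preimage_add {E : Type*} [AddGroup E] (h : E) (R : Set E) :
    (fun x => x - h) '' R = (fun x => x + h) ⁻¹' R :=
  congrFun (Set.image_eq_preimage_of_inverse (fun x => sub_add_cancel x h)
    (fun x => add_sub_cancel_right x h)) R

section OverlapVol

variable {d n : ℕ} {t : Fin n → EuclideanSpace ℝ (Fin d)}

theorem overlapVol_eq (h : EuclideanSpace ℝ (Fin d)) :
    overlapVol t h = volume.real (region t ∩ (fun x => x + h) ⁻¹' region t) := by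
  rw [overlapVol, image_sub_eq_preimage_add]

theorem overlapVol_zero : overlapVol t 0 = regionVol t := by
  simp only [overlapVol_eq, add_zero, Set.preimage_id', Set.inter_self, regionVol]

variable {x₀ : EuclideanSpace ℝ (Fin d)} {ρ : ℝ}

theorem abs_overlapVol_sub_le (hρ : 0 < ρ) (hball : Metric.closedBall x₀ ρ ⊆ region t)
    (h h' : EuclideanSpace ℝ (Fin d)) :
    |overlapVol t h - overlapVol t h'| ≤ d * (‖h - h'‖ / ρ) * regionVol t := by
  have hle := measureReal_inter_preimage_add_sub_le volume (isCompact_region t)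
    (convex_region t) hρ hball
  rw [finrank_euclideanSpace_fin] at hle
  rw [abs_sub_le_iff, overlapVol_eq, overlapVol_eq]
  exact ⟨hle h h', norm_sub_rev h h' ▸ hle h' h⟩

theorem half_regionVol_le_overlapVol (hρ : 0 < ρ) (hball : Metric.closedBall x₀ ρ ⊆ region t)
    {h : EuclideanSpace ℝ (Fin d)} (hh : 2 * d * ‖h‖ ≤ ρ) :
    regionVol t / 2 ≤ overlapVol t h := by
  have hdiff := (abs_sub_le_iff.1 (abs_overlapVol_sub_le hρ hball 0 h)).1
  rw [overlapVol_zero, zero_sub, norm_neg] at hdiff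
  have hratio : d * (‖h‖ / ρ) ≤ 1 / 2 := by
    rw [mul_div_assoc', div_le_iff₀ hρ]
    linarith
  have hvol : 0 ≤ regionVol t := measureReal_nonneg
  linarith [mul_le_mul_of_nonneg_right hratio hvol]

end OverlapVol

/-! ### Inscribed balls -/

section InscribedBall

/-- If a point `z` of the smaller ball were outside `S`, moving it by `r` away from its projection
on `S` would give a point of `T` at distance more than `r` from `S`. -/
theorem closedBall_subset_of_hausdorffEDist_lt {E : Type*} [NormedAddCommGroup E]
    [InnerProductSpace ℝ E] {S T : Set E} (hS : IsComplete S) (hSc : Convex ℝ S) {x₀ : E} {r : ℝ}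
    (hr : 0 < r) (hball : Metric.closedBall x₀ (2 * r) ⊆ T)
    (hdist : Metric.hausdorffEDist S T < ENNReal.ofReal r) : Metric.closedBall x₀ r ⊆ S := by
  intro z hz
  by_contra hzS
  rw [Metric.hausdorffEDist_comm] at hdist
  obtain ⟨s₀, hs₀, -⟩ := Metric.exists_edist_lt_of_hausdorffEDist_lt
    (hball (Metric.mem_closedBall_self (by positivity))) hdist
  obtain ⟨p, hp, hmin⟩ := exists_norm_eq_iInf_of_complete_convex ⟨s₀, hs₀⟩ hS hSc z
  rw [norm_eq_iInf_iff_real_inner_le_zero hSc hp] at hmin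
  have hv : 0 < ‖z - p‖ := norm_sub_pos_iff.2 fun h => hzS (h ▸ hp)
  set v := z - p
  set w := z + (r / ‖v‖) • v
  have hwT : w ∈ T := by
    refine hball (mem_closedBall_iff_norm.2 ?_)
    calc ‖w - x₀‖ = ‖(z - x₀) + (r / ‖v‖) • v‖ := by rw [add_sub_right_comm]
      _ ≤ ‖z - x₀‖ + ‖(r / ‖v‖) • v‖ := norm_add_le _ _
      _ ≤ r + r := by
          gcongr
          · exact mem_closedBall_iff_norm.1 hz
          · rw [norm_smul, Real.norm_of_nonneg (by positivity), div_mul_cancel₀ _ hv.ne']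
      _ = 2 * r := (two_mul r).symm
  obtain ⟨s, hs, hws⟩ := Metric.exists_edist_lt_of_hausdorffEDist_lt hwT hdist
  rw [edist_lt_ofReal, dist_eq_norm] at hws
  have hinner : inner ℝ v (w - s) = ‖v‖ ^ 2 + r * ‖v‖ - inner ℝ v (s - p) := by
    rw [show w - s = v + (r / ‖v‖) • v - (s - p) by simp only [w, v]; abel, inner_sub_right,
      inner_add_right, inner_smul_right, real_inner_self_eq_norm_sq, sq, ← mul_assoc,
      div_mul_cancel₀ _ hv.ne']
  nlinarith [mul_lt_mul_of_pos_left hws hv, sq_nonneg ‖v‖, real_inner_le_norm v (w - s),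
    hmin s hs]

variable {d : ℕ} {t : (n : ℕ) → Fin n → EuclideanSpace ℝ (Fin d)}

theorem SamplingAssumption.dim_ne_zero (hS : SamplingAssumption t) : d ≠ 0 := by
  rintro rfl
  obtain ⟨n, hn⟩ := (hS.vol_tendsto.eventually_gt_atTop
    (volume.real (Set.univ : Set (EuclideanSpace ℝ (Fin 0))))).exists
  exact hn.not_ge (measureReal_mono (Set.subset_univ _)
    (Set.subsingleton_univ.finite.isCompact.measure_lt_top.ne))

theorem smul_closedBall_subset_of_subset_inv_smul {E : Type*} [NormedAddCommGroup E]
    [NormedSpace ℝ E] {R : Set E} {c r : ℝ} (hc : 0 < c) {x : E}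
    (h : Metric.closedBall x r ⊆ c⁻¹ • R) : Metric.closedBall (c • x) (c * r) ⊆ R := by
  have hsmul := Set.smul_set_mono (a := c) h
  rwa [smul_inv_smul₀ hc.ne', _root_.smul_closedBall' hc.ne', Real.norm_of_nonneg hc.le] at hsmul

theorem SamplingAssumption.eventually_closedBall_subset (hS : SamplingAssumption t) {Δ : ℕ → ℝ}
    (hΔvol : Tendsto (fun n => Δ n ^ d / regionVol (t n)) atTop (𝓝 0)) {A : ℝ} (hA : 0 < A) :
    ∀ᶠ n in atTop, ∃ x₀, Metric.closedBall x₀ (A * Δ n) ⊆ region (t n) := by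
  obtain ⟨T, -, -, ⟨x, hx⟩, hT⟩ := hS.shape
  obtain ⟨ε, hε, hball⟩ := Metric.isOpen_iff.1 isOpen_interior x hx
  have hr : 0 < ε / 4 := by positivity
  set r := ε / 4
  have hballT : Metric.closedBall x (2 * r) ⊆ T :=
    (Metric.closedBall_subset_ball (by simp only [r]; linarith)).trans
      (hball.trans interior_subset)
  filter_upwards [hT.eventually (gt_mem_nhds (ENNReal.ofReal_pos.2 hr)),
    hΔvol.eventually (gt_mem_nhds (show 0 < (r / A) ^ d by positivity)),
    hS.vol_tendsto.eventually_gt_atTop 0] with n hdist hratio hvol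
  set c := regionVol (t n) ^ (1 / (d : ℝ)) with hc
  have hcpos : 0 < c := Real.rpow_pos_of_pos hvol _
  have hcd : c ^ d = regionVol (t n) := by
    rw [hc, one_div, Real.rpow_inv_natCast_pow hvol.le hS.dim_ne_zero]
  have hsub := closedBall_subset_of_hausdorffEDist_lt
    ((isCompact_region (t n)).smul c⁻¹).isComplete ((convex_region (t n)).smul c⁻¹) hr hballT hdist
  have hle : A * Δ n ≤ c * r := by
    rw [← hcd, ← div_pow] at hratio
    have hlt := lt_of_pow_lt_pow_left₀ d (by positivity) hratio
    rw [div_lt_div_iff₀ hcpos hA] at hlt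
    linarith
  exact ⟨c • x, (Metric.closedBall_subset_closedBall hle).trans
    (smul_closedBall_subset_of_subset_inv_smul hcpos hsub)⟩

end InscribedBall

/-! ### Weighted sums over Voronoi cells -/

section VoronoiSums

variable {d n : ℕ} {t : Fin n → EuclideanSpace ℝ (Fin d)}

theorem sum_volume_cell_mul_le_lintegral (ht : Function.Injective t) {f : Fin n → ℝ≥0∞}
    {F : EuclideanSpace ℝ (Fin d) → ℝ≥0∞} (hF : ∀ i, ∀ x ∈ cell t i, f i ≤ F x) :
    ∑ i, volume (cell t i) * f i ≤ ∫⁻ x, F x :=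
  calc ∑ i, volume (cell t i) * f i = ∑ i, ∫⁻ _ in disjointCell t i, f i := by
        simp only [setLIntegral_const, volume_disjointCell t ht, mul_comm]
    _ ≤ ∑ i, ∫⁻ x in disjointCell t i, F x :=
        Finset.sum_le_sum fun i _ => setLIntegral_mono' (measurableSet_disjointCell t i)
          fun x hx => hF i x (disjointCell_subset_cell t i hx)
    _ = ∫⁻ x in ⋃ i, disjointCell t i, F x := by
        rw [lintegral_iUnion (measurableSet_disjointCell t) (pairwise_disjoint_disjointCell t),
          tsum_fintype]
    _ ≤ ∫⁻ x, F x := setLIntegral_le_lintegral _ _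

theorem sum_volume_cell (ht : Function.Injective t) :
    ∑ i, volume (cell t i) = volume (region t) := by
  rw [← iUnion_disjointCell, measure_iUnion (pairwise_disjoint_disjointCell t)
    (measurableSet_disjointCell t), tsum_fintype]
  exact Finset.sum_congr rfl fun i _ => (volume_disjointCell t ht i).symm

theorem indicator_closedBall_sub_le (r : ℝ) (a : EuclideanSpace ℝ (Fin d)) {j : Fin n}
    {x : EuclideanSpace ℝ (Fin d)} (hx : x ∈ cell t j) :
    (Metric.closedBall (0 : EuclideanSpace ℝ (Fin d)) r).indicator 1 (a - t j) ≤
      (Metric.closedBall a (r + tessDiam t)).indicator (1 : EuclideanSpace ℝ (Fin d) → ℝ≥0∞) x := by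
  refine Set.indicator_apply_le' (fun h => ?_) fun _ => zero_le
  have hx' : x ∈ Metric.closedBall a (r + tessDiam t) := by
    rw [mem_closedBall_zero_iff] at h
    rw [mem_closedBall_iff_norm]
    calc ‖x - a‖ = ‖(x - t j) - (a - t j)‖ := by rw [sub_sub_sub_cancel_right]
      _ ≤ ‖x - t j‖ + ‖a - t j‖ := norm_sub_le _ _
      _ ≤ r + tessDiam t := by linarith [norm_sub_le_tessDiam t hx]
  rw [Set.indicator_of_mem hx', Pi.one_apply, Pi.one_apply]

theorem sum_volume_cell_mul_indicator_le (ht : Function.Injective t) (r : ℝ) :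
    ∑ i, ∑ j, volume (cell t i) * volume (cell t j) *
        (Metric.closedBall (0 : EuclideanSpace ℝ (Fin d)) r).indicator 1 (t i - t j) ≤
      volume (region t) *
        volume (Metric.closedBall (0 : EuclideanSpace ℝ (Fin d)) (r + tessDiam t)) := by
  simp_rw [← sum_volume_cell ht, Finset.sum_mul, mul_assoc, ← Finset.mul_sum]
  gcongr with i
  refine (sum_volume_cell_mul_le_lintegral ht fun j x hx =>
    indicator_closedBall_sub_le r (t i) hx).trans_eq ?_
  rw [lintegral_indicator_one Metric.isClosed_closedBall.measurableSet,
    Measure.addHaar_closedBall_center]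

end VoronoiSums

section FourfoldSums

variable {α : Type*} [Fintype α]

theorem sum_pair_comm {M : Type*} [AddCommMonoid M] (f : α → α → α → α → M) :
    ∑ i, ∑ j, ∑ k, ∑ l, f i j k l = ∑ k, ∑ l, ∑ i, ∑ j, f i j k l := by
  calc ∑ i, ∑ j, ∑ k, ∑ l, f i j k l = ∑ p : α × α, ∑ q : α × α, f p.1 p.2 q.1 q.2 := by
        simp only [Fintype.sum_prod_type]
    _ = ∑ q : α × α, ∑ p : α × α, f p.1 p.2 q.1 q.2 := Finset.sum_comm
    _ = _ := by simp only [Fintype.sum_prod_type]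

variable {V : α → ℝ≥0∞} {χ : α → α → ℝ≥0∞} {Q S : ℝ≥0∞}

theorem sum_weight_mul_weight_mul_le (hχ : ∀ i j, χ i j ≤ 1)
    (hQ : ∑ i, ∑ j, V i * V j * χ i j ≤ Q) {c : α → α → α → α → ℝ≥0∞} {B : ℝ≥0∞}
    (hc : ∀ k l, ∑ i, V i * ∑ j, V j * c i j k l ≤ B) :
    ∑ i, ∑ j, ∑ k, ∑ l, (V i * V j * χ i j) * (V k * V l * χ k l) * c i j k l ≤ Q * B := by
  calc ∑ i, ∑ j, ∑ k, ∑ l, (V i * V j * χ i j) * (V k * V l * χ k l) * c i j k l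
      ≤ ∑ i, ∑ j, ∑ k, ∑ l, (V i * V j * 1) * (V k * V l * χ k l) * c i j k l := by
        gcongr; exact hχ _ _
    _ = ∑ i, ∑ j, ∑ k, ∑ l, (V k * V l * χ k l) * (V i * (V j * c i j k l)) :=
        Finset.sum_congr rfl fun i _ => Finset.sum_congr rfl fun j _ =>
          Finset.sum_congr rfl fun k _ => Finset.sum_congr rfl fun l _ => by ring
    _ = ∑ k, ∑ l, (V k * V l * χ k l) * ∑ i, V i * ∑ j, V j * c i j k l := by
        simp_rw [Finset.mul_sum]
        exact sum_pair_comm _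
    _ ≤ ∑ k, ∑ l, (V k * V l * χ k l) * B := by gcongr; exact hc _ _
    _ ≤ Q * B := by simp_rw [← Finset.sum_mul]; gcongr

theorem sum_weight_mul_weight_mul_mul_le (hχ : ∀ i j, χ i j ≤ 1)
    (hQ : ∑ i, ∑ j, V i * V j * χ i j ≤ Q) {f g : α → α → α → ℝ≥0∞}
    (hf : ∀ i j, ∑ k, V k * f i j k ≤ S) (hg : ∀ i j, ∑ l, V l * g i j l ≤ S) :
    ∑ i, ∑ j, ∑ k, ∑ l, (V i * V j * χ i j) * (V k * V l * χ k l) * (f i j k * g i j l)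
      ≤ Q * S ^ 2 := by
  calc ∑ i, ∑ j, ∑ k, ∑ l, (V i * V j * χ i j) * (V k * V l * χ k l) * (f i j k * g i j l)
      ≤ ∑ i, ∑ j, ∑ k, ∑ l, (V i * V j * χ i j) * (V k * V l * 1) * (f i j k * g i j l) := by
        gcongr; exact hχ _ _
    _ = ∑ i, ∑ j, ∑ k, ∑ l, (V i * V j * χ i j) * ((V k * f i j k) * (V l * g i j l)) :=
        Finset.sum_congr rfl fun i _ => Finset.sum_congr rfl fun j _ =>
          Finset.sum_congr rfl fun k _ => Finset.sum_congr rfl fun l _ => by ring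
    _ = ∑ i, ∑ j, (V i * V j * χ i j) * ((∑ k, V k * f i j k) * ∑ l, V l * g i j l) := by
        simp_rw [Finset.sum_mul_sum, Finset.mul_sum]
    _ ≤ ∑ i, ∑ j, (V i * V j * χ i j) * (S * S) := by gcongr <;> [exact hf _ _; exact hg _ _]
    _ ≤ Q * S ^ 2 := by simp_rw [← Finset.sum_mul]; rw [sq]; gcongr

theorem sum_weight_mul_weight_mul_add_le (hχ : ∀ i j, χ i j ≤ 1)
    (hQ : ∑ i, ∑ j, V i * V j * χ i j ≤ Q) {c : α → α → α → α → ℝ≥0∞} {a : α → α → ℝ≥0∞}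
    {B : ℝ≥0∞} (hc : ∀ k l, ∑ i, V i * ∑ j, V j * c i j k l ≤ B)
    (ha₁ : ∀ i, ∑ k, V k * a k i ≤ S) (ha₂ : ∀ i, ∑ k, V k * a i k ≤ S) :
    ∑ i, ∑ j, ∑ k, ∑ l, (V i * V j * χ i j) * (V k * V l * χ k l) *
      (c i j k l + a k i * a j l + a k j * a i l) ≤ Q * (B + 2 * S ^ 2) := by
  have hdirect := sum_weight_mul_weight_mul_mul_le hχ hQ (f := fun i _ k => a k i)
    (g := fun _ j l => a j l) (fun i _ => ha₁ i) fun _ j => ha₂ j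
  have hcross := sum_weight_mul_weight_mul_mul_le hχ hQ (f := fun _ j k => a k j)
    (g := fun i _ l => a i l) (fun _ j => ha₁ j) fun i _ => ha₂ i
  simp_rw [mul_add, Finset.sum_add_distrib]
  calc _ ≤ Q * B + Q * S ^ 2 + Q * S ^ 2 := by
        gcongr
        exact sum_weight_mul_weight_mul_le hχ hQ hc
    _ = Q * B + Q * (2 * S ^ 2) := by ring

end FourfoldSums

section TraceOsc

variable {d n : ℕ} {t : Fin n → EuclideanSpace ℝ (Fin d)} {ι H : Type*} [NormedAddCommGroup H]
  [InnerProductSpace ℂ H] [CompleteSpace H] (b : HilbertBasis ι ℂ H)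
  {C : EuclideanSpace ℝ (Fin d) → H →L[ℂ] H}

/-- The oscillation of `C` in trace norm at scale `δ`. -/
def traceOsc (C : EuclideanSpace ℝ (Fin d) → H →L[ℂ] H) (δ : ℝ)
    (x : EuclideanSpace ℝ (Fin d)) : ℝ≥0∞ :=
  ⨆ y ∈ Metric.closedBall x δ, traceNorm b (C y - C x)

theorem traceNorm_sub_le_traceOsc {δ : ℝ} {x y : EuclideanSpace ℝ (Fin d)} (hxy : ‖y - x‖ ≤ δ) :
    traceNorm b (C y - C x) ≤ traceOsc b C δ x :=
  le_iSup₂_of_le y (mem_closedBall_iff_norm.2 hxy) le_rfl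

theorem hsTraceNorm_le_add_traceOsc {δ : ℝ} {x y : EuclideanSpace ℝ (Fin d)}
    (hxy : ‖y - x‖ ≤ δ) :
    hsTraceNorm b (C y) ≤ hsTraceNorm b (C x) + 2 * traceOsc b C δ x := by
  calc hsTraceNorm b (C y) = hsTraceNorm b (C x + (C y - C x)) := by rw [add_sub_cancel]
    _ ≤ hsTraceNorm b (C x) + hsTraceNorm b (C y - C x) := hsTraceNorm_add_le b _ _
    _ ≤ hsTraceNorm b (C x) + 2 * traceOsc b C δ x := by
        gcongr
        exact (hsTraceNorm_le b _).trans (by gcongr; exact traceNorm_sub_le_traceOsc b hxy)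

theorem sum_volume_cell_mul_hsTraceNorm_le (ht : Function.Injective t)
    (hC : AEStronglyMeasurable C volume) (g : EuclideanSpace ℝ (Fin d) ≃ᵐ EuclideanSpace ℝ (Fin d))
    (hg : Isometry g) (hgvol : MeasurePreserving g) :
    ∑ k, volume (cell t k) * hsTraceNorm b (C (g (t k))) ≤
      (∫⁻ h, hsTraceNorm b (C h)) + 2 * ∫⁻ h, traceOsc b C (tessDiam t) h := by
  calc ∑ k, volume (cell t k) * hsTraceNorm b (C (g (t k)))
      ≤ ∫⁻ x, (hsTraceNorm b (C (g x)) + 2 * traceOsc b C (tessDiam t) (g x)) := by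
        refine sum_volume_cell_mul_le_lintegral ht fun k x hx => hsTraceNorm_le_add_traceOsc b ?_
        rw [← dist_eq_norm, hg.dist_eq, dist_comm, dist_eq_norm]
        exact norm_sub_le_tessDiam t hx
    _ = ∫⁻ x, (hsTraceNorm b (C x) + 2 * traceOsc b C (tessDiam t) x) :=
        hgvol.lintegral_comp_emb g.measurableEmbedding
          fun x => hsTraceNorm b (C x) + 2 * traceOsc b C (tessDiam t) x
    _ = _ := by
        rw [lintegral_add_left' (aemeasurable_hsTraceNorm b hC),
          lintegral_const_mul' _ _ ENNReal.ofNat_ne_top]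

theorem sum_volume_cell_mul_sum_le_lintegral_iSup (ht : Function.Injective t)
    (c : EuclideanSpace ℝ (Fin d) → EuclideanSpace ℝ (Fin d) → EuclideanSpace ℝ (Fin d) → ℝ≥0∞)
    {δ : ℝ} (hδ : tessDiam t < δ) (a w : EuclideanSpace ℝ (Fin d)) :
    ∑ i, volume (cell t i) * ∑ j, volume (cell t j) * c (t i - a) (t j - a) w ≤
      ∫⁻ u, ∫⁻ v, ⨆ l₁ ∈ Metric.ball (0 : EuclideanSpace ℝ (Fin d)) δ,
        ⨆ l₂ ∈ Metric.ball (0 : EuclideanSpace ℝ (Fin d)) δ,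
        ⨆ l₃ ∈ Metric.ball (0 : EuclideanSpace ℝ (Fin d)) δ, c (l₁ + u) (l₂ + v) (l₃ + w) := by
  have hmem : ∀ i, ∀ x ∈ cell t i, t i - x ∈ Metric.ball (0 : EuclideanSpace ℝ (Fin d)) δ := by
    intro i x hx
    rw [mem_ball_zero_iff, norm_sub_rev]
    exact (norm_sub_le_tessDiam t hx).trans_lt hδ
  set G : EuclideanSpace ℝ (Fin d) → EuclideanSpace ℝ (Fin d) → ℝ≥0∞ := fun u v =>
    ⨆ l₁ ∈ Metric.ball (0 : EuclideanSpace ℝ (Fin d)) δ,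
      ⨆ l₂ ∈ Metric.ball (0 : EuclideanSpace ℝ (Fin d)) δ,
      ⨆ l₃ ∈ Metric.ball (0 : EuclideanSpace ℝ (Fin d)) δ, c (l₁ + u) (l₂ + v) (l₃ + w)
  have hG : ∀ i, ∀ x ∈ cell t i, ∀ j, ∀ y ∈ cell t j,
      c (t i - a) (t j - a) w ≤ G (x - a) (y - a) := fun i x hx j y hy =>
    le_iSup₂_of_le (t i - x) (hmem i x hx) <| le_iSup₂_of_le (t j - y) (hmem j y hy) <|
      le_iSup₂_of_le 0 (Metric.mem_ball_self ((tessDiam_nonneg t).trans_lt hδ)) <| by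
        rw [sub_add_sub_cancel, sub_add_sub_cancel, zero_add]
  calc ∑ i, volume (cell t i) * ∑ j, volume (cell t j) * c (t i - a) (t j - a) w
      ≤ ∫⁻ x, ∫⁻ y, G (x - a) (y - a) := sum_volume_cell_mul_le_lintegral ht fun i x hx =>
        sum_volume_cell_mul_le_lintegral ht fun j y hy => hG i x hx j y hy
    _ = ∫⁻ u, ∫⁻ v, G u v := by
        rw [lintegral_sub_right_eq_self (fun u => ∫⁻ y, G u (y - a)) a]
        exact lintegral_congr fun u => lintegral_sub_right_eq_self (G u) a

end TraceOsc

/-! ### Riemann sums over pairs of Voronoi cells -/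

section CellOverlap

variable {d n : ℕ} {t : Fin n → EuclideanSpace ℝ (Fin d)}

/-- The volume of the set of `y` in the `j`-th cell such that `y + h` is in the `i`-th cell. As a
function of `h` it has integral `|V(tᵢ)| |V(tⱼ)|`, and the sum over `i, j` is `|T ∩ (T - h)|`. -/
def cellOverlap (t : Fin n → EuclideanSpace ℝ (Fin d)) (i j : Fin n)
    (h : EuclideanSpace ℝ (Fin d)) : ℝ≥0∞ :=
  volume (disjointCell t j ∩ (fun y => y + h) ⁻¹' disjointCell t i)

theorem measurableSet_add_mem_disjointCell (i j : Fin n) :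
    MeasurableSet {p : EuclideanSpace ℝ (Fin d) × EuclideanSpace ℝ (Fin d) |
      p.2 ∈ disjointCell t j ∧ p.2 + p.1 ∈ disjointCell t i} :=
  (measurable_snd (measurableSet_disjointCell t j)).inter
    ((measurable_snd.add measurable_fst) (measurableSet_disjointCell t i))

theorem measurable_cellOverlap (i j : Fin n) : Measurable (cellOverlap t i j) :=
  measurable_measure_prodMk_left (measurableSet_add_mem_disjointCell i j)

theorem volume_setOf_add_mem_disjointCell (ht : Function.Injective t) (i j : Fin n)
    (y : EuclideanSpace ℝ (Fin d)) :
    volume {h | y ∈ disjointCell t j ∧ y + h ∈ disjointCell t i} =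
      (disjointCell t j).indicator (fun _ => volume (cell t i)) y := by
  by_cases hy : y ∈ disjointCell t j
  · simp only [hy, true_and, Set.indicator_of_mem]
    rw [← volume_disjointCell t ht i, ← measure_preimage_add volume y (disjointCell t i)]
    rfl
  · simp only [hy, false_and, Set.ofPred_false, measure_empty, not_false_eq_true,
      Set.indicator_of_notMem]

theorem lintegral_cellOverlap (ht : Function.Injective t) (i j : Fin n) :
    ∫⁻ h, cellOverlap t i j h = volume (cell t i) * volume (cell t j) := by
  have hmeas := measurableSet_add_mem_disjointCell (t := t) i j
  calc ∫⁻ h, cellOverlap t i j h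
      = ∫⁻ y, volume {h | y ∈ disjointCell t j ∧ y + h ∈ disjointCell t i} :=
        (Measure.prod_apply (μ := volume) (ν := volume) hmeas).symm.trans
          (Measure.prod_apply_symm hmeas)
    _ = volume (cell t i) * volume (cell t j) := by
        simp only [volume_setOf_add_mem_disjointCell ht]
        rw [lintegral_indicator_const (measurableSet_disjointCell t j), volume_disjointCell t ht]

theorem sum_volume_inter_disjointCell (s : Set (EuclideanSpace ℝ (Fin d)))
    {g : EuclideanSpace ℝ (Fin d) → EuclideanSpace ℝ (Fin d)} (hg : Measurable g) :
    ∑ i, volume (s ∩ g ⁻¹' disjointCell t i) = volume (s ∩ g ⁻¹' region t) := by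
  have hdisj : Pairwise (Function.onFun Disjoint fun i => g ⁻¹' disjointCell t i) :=
    fun i j hij => (pairwise_disjoint_disjointCell t hij).preimage g
  have hmeas := fun i => hg (measurableSet_disjointCell t i)
  rw [← iUnion_disjointCell, Set.preimage_iUnion, Set.inter_comm s,
    ← Measure.restrict_apply (MeasurableSet.iUnion hmeas), measure_iUnion hdisj hmeas, tsum_fintype]
  exact Finset.sum_congr rfl fun i _ => by rw [Measure.restrict_apply (hmeas i), Set.inter_comm]

theorem sum_cellOverlap (h : EuclideanSpace ℝ (Fin d)) :
    ∑ i, ∑ j, cellOverlap t i j h = volume (region t ∩ (fun y => y + h) ⁻¹' region t) := by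
  have hinner : ∀ i, ∑ j, cellOverlap t i j h =
      volume (region t ∩ (fun y => y + h) ⁻¹' disjointCell t i) := fun i => by
    simpa only [cellOverlap, Set.inter_comm, Set.preimage_id_eq, id] using
      sum_volume_inter_disjointCell ((fun y => y + h) ⁻¹' disjointCell t i) measurable_id
  simp only [hinner, sum_volume_inter_disjointCell (region t) (measurable_add_const h)]

theorem cellOverlap_lt_top (i j : Fin n) (h : EuclideanSpace ℝ (Fin d)) :
    cellOverlap t i j h < ∞ :=
  (measure_mono (Set.inter_subset_left.trans ((disjointCell_subset_cell t j).trans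
    (cell_subset_region t j)))).trans_lt (isCompact_region t).measure_lt_top

theorem overlapVol_eq_sum (h : EuclideanSpace ℝ (Fin d)) :
    overlapVol t h = ∑ i, ∑ j, (cellOverlap t i j h).toReal := by
  have hfin : ∀ i j, cellOverlap t i j h ≠ ∞ := fun i j => (cellOverlap_lt_top i j h).ne
  rw [overlapVol_eq, measureReal_def, ← sum_cellOverlap,
    ENNReal.toReal_sum fun i _ => ENNReal.sum_ne_top.2 fun j _ => hfin i j]
  exact Finset.sum_congr rfl fun i _ => ENNReal.toReal_sum fun j _ => hfin i j

theorem toReal_cellOverlap_le (i j : Fin n) (h : EuclideanSpace ℝ (Fin d)) :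
    (cellOverlap t i j h).toReal ≤ overlapVol t h := by
  rw [overlapVol_eq_sum]
  calc (cellOverlap t i j h).toReal ≤ ∑ j, (cellOverlap t i j h).toReal :=
        Finset.single_le_sum (f := fun j => (cellOverlap t i j h).toReal)
          (fun _ _ => ENNReal.toReal_nonneg) (Finset.mem_univ j)
    _ ≤ ∑ i, ∑ j, (cellOverlap t i j h).toReal :=
        Finset.single_le_sum (f := fun i => ∑ j, (cellOverlap t i j h).toReal)
          (fun _ _ => Finset.sum_nonneg fun _ _ => ENNReal.toReal_nonneg) (Finset.mem_univ i)

theorem measurable_overlapVol : Measurable (overlapVol t) := by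
  rw [funext (overlapVol_eq_sum (t := t))]
  exact Finset.measurable_sum _ fun i _ => Finset.measurable_sum _ fun j _ =>
    (measurable_cellOverlap i j).ennreal_toReal

theorem integrable_toReal_cellOverlap (ht : Function.Injective t) (i j : Fin n) :
    Integrable fun h => (cellOverlap t i j h).toReal := by
  refine integrable_toReal_of_lintegral_ne_top (measurable_cellOverlap i j).aemeasurable ?_
  rw [lintegral_cellOverlap ht]
  exact (ENNReal.mul_lt_top (volume_cell_lt_top t i) (volume_cell_lt_top t j)).ne

theorem integral_toReal_cellOverlap (ht : Function.Injective t) (i j : Fin n) :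
    ∫ h, (cellOverlap t i j h).toReal = volume.real (cell t i) * volume.real (cell t j) := by
  rw [integral_toReal (measurable_cellOverlap i j).aemeasurable
    (Eventually.of_forall (cellOverlap_lt_top i j)), lintegral_cellOverlap ht, ENNReal.toReal_mul,
    measureReal_def, measureReal_def]

theorem norm_sub_le_of_cellOverlap_ne_zero {i j : Fin n} {h : EuclideanSpace ℝ (Fin d)}
    (hne : cellOverlap t i j h ≠ 0) : ‖t i - t j - h‖ ≤ 2 * tessDiam t := by
  obtain ⟨y, hyj, hyi⟩ := nonempty_of_measure_ne_zero hne
  have hj := norm_sub_le_tessDiam t (disjointCell_subset_cell t j hyj)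
  have hi := norm_sub_le_tessDiam t (disjointCell_subset_cell t i hyi)
  calc ‖t i - t j - h‖ = ‖(y - t j) - (y + h - t i)‖ := by congr 1; abel
    _ ≤ ‖y - t j‖ + ‖y + h - t i‖ := norm_sub_le _ _
    _ ≤ 2 * tessDiam t := by linarith

end CellOverlap

section RiemannSum

variable {d n : ℕ} {t : Fin n → EuclideanSpace ℝ (Fin d)}

theorem sum_smul_sub_integral_eq {F : Type*} [NormedAddCommGroup F] [NormedSpace ℝ F]
    [CompleteSpace F] (ht : Function.Injective t) {G : EuclideanSpace ℝ (Fin d) → F}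
    (hG : AEStronglyMeasurable G) (hGint : Integrable fun h => overlapVol t h • G h) :
    ∑ i, ∑ j, (volume.real (cell t i) * volume.real (cell t j)) • G (t i - t j)
      - ∫ h, overlapVol t h • G h =
      ∫ h, ∑ i, ∑ j, (cellOverlap t i j h).toReal • (G (t i - t j) - G h) := by
  have hconst : ∀ i j, Integrable fun h => (cellOverlap t i j h).toReal • G (t i - t j) :=
    fun i j => (integrable_toReal_cellOverlap ht i j).smul_const _
  have hvar : ∀ i j, Integrable fun h => (cellOverlap t i j h).toReal • G h := fun i j =>
    hGint.mono ((measurable_cellOverlap i j).ennreal_toReal.aestronglyMeasurable.smul hG)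
      (Eventually.of_forall fun h => by
        rw [norm_smul, norm_smul, Real.norm_of_nonneg ENNReal.toReal_nonneg]
        gcongr
        exact (toReal_cellOverlap_le i j h).trans (Real.le_norm_self _))
  have hdiff : ∀ i j, Integrable fun h =>
      (cellOverlap t i j h).toReal • G (t i - t j) - (cellOverlap t i j h).toReal • G h :=
    fun i j => (hconst i j).sub (hvar i j)
  simp only [overlapVol_eq_sum, Finset.sum_smul, smul_sub]
  rw [integral_finsetSum _ fun i _ => integrable_finsetSum _ fun j _ => hvar i j,
    integral_finsetSum _ fun i _ => integrable_finsetSum _ fun j _ => hdiff i j,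
    ← Finset.sum_sub_distrib]
  refine Finset.sum_congr rfl fun i _ => ?_
  rw [integral_finsetSum _ fun j _ => hvar i j, integral_finsetSum _ fun j _ => hdiff i j,
    ← Finset.sum_sub_distrib]
  refine Finset.sum_congr rfl fun j _ => ?_
  rw [integral_sub (hconst i j) (hvar i j), integral_smul_const, integral_toReal_cellOverlap ht]

variable {ι H : Type*} [NormedAddCommGroup H] [InnerProductSpace ℂ H] [CompleteSpace H]
  (b : HilbertBasis ι ℂ H)

theorem hsNorm_sum_smul_sub_integral_le (ht : Function.Injective t)
    {G : EuclideanSpace ℝ (Fin d) → H →L[ℂ] H} (hG : AEStronglyMeasurable G)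
    (hGint : Integrable fun h => overlapVol t h • G h) {Φ : EuclideanSpace ℝ (Fin d) → ℝ≥0∞}
    (hΦ : ∀ x h, ‖x - h‖ ≤ 2 * tessDiam t → hsNorm b (G x - G h) ≤ Φ h) :
    hsNorm b (∑ i, ∑ j, (volume.real (cell t i) * volume.real (cell t j)) • G (t i - t j)
      - ∫ h, overlapVol t h • G h) ≤ volume (region t) * ∫⁻ h, Φ h := by
  have hterm : ∀ i j h, hsNorm b ((cellOverlap t i j h).toReal • (G (t i - t j) - G h)) ≤
      cellOverlap t i j h * Φ h := by
    intro i j h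
    rw [← Complex.coe_smul, hsNorm_smul, ← ofReal_norm, Complex.norm_real,
      Real.norm_of_nonneg ENNReal.toReal_nonneg,
      ENNReal.ofReal_toReal (cellOverlap_lt_top i j h).ne]
    by_cases hzero : cellOverlap t i j h = 0
    · rw [hzero, zero_mul, zero_mul]
    · gcongr
      exact hΦ _ _ (norm_sub_le_of_cellOverlap_ne_zero hzero)
  rw [sum_smul_sub_integral_eq ht hG hGint]
  calc hsNorm b (∫ h, ∑ i, ∑ j, (cellOverlap t i j h).toReal • (G (t i - t j) - G h))
      ≤ ∫⁻ h, hsNorm b (∑ i, ∑ j, (cellOverlap t i j h).toReal • (G (t i - t j) - G h)) :=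
        hsNorm_integral_le b _
    _ ≤ ∫⁻ h, volume (region t) * Φ h := lintegral_mono fun h =>
        calc _ ≤ ∑ i, ∑ j, cellOverlap t i j h * Φ h :=
              (hsNorm_sum_le b _ _).trans <| Finset.sum_le_sum fun i _ =>
                (hsNorm_sum_le b _ _).trans <| Finset.sum_le_sum fun j _ => hterm i j h
          _ = volume (region t ∩ (fun y => y + h) ⁻¹' region t) * Φ h := by
              simp only [← Finset.sum_mul, sum_cellOverlap]
          _ ≤ volume (region t) * Φ h := by gcongr; exact Set.inter_subset_left
    _ = volume (region t) * ∫⁻ h, Φ h :=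
        lintegral_const_mul' _ _ (isCompact_region t).measure_lt_top.ne

end RiemannSum

/-! ### Lag windows and the weights of the estimator -/

section Character

variable {d : ℕ}

theorem norm_character (h θ : EuclideanSpace ℝ (Fin d)) : ‖character h θ‖ = 1 := by
  rw [character, mul_comm, Complex.norm_exp_ofReal_mul_I]

theorem continuous_character (θ : EuclideanSpace ℝ (Fin d)) :
    Continuous fun h => character h θ := by
  unfold character
  fun_prop

theorem norm_character_sub_le (h h' θ : EuclideanSpace ℝ (Fin d)) :
    ‖character h' θ - character h θ‖ ≤ ‖θ‖ * ‖h' - h‖ := by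
  have hfactor : character h' θ - character h θ = character h θ *
      (Complex.exp (Complex.I * ((inner ℝ (h' - h) θ : ℝ) : ℂ)) - 1) := by
    rw [mul_sub, mul_one, character, character, ← Complex.exp_add, inner_sub_left]
    push_cast
    ring_nf
  rw [hfactor, norm_mul, norm_character, one_mul]
  refine Real.norm_exp_I_mul_ofReal_sub_one_le.trans ?_
  rw [mul_comm]
  exact norm_inner_le_norm _ _

end Character

section LagWindow

variable {d n : ℕ} {K : EuclideanSpace ℝ (Fin d) → ℝ} {R L : ℝ≥0}

/-- A lag window: a Lipschitz continuous function with values in `[0, 1]` that vanishes outside the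
closed ball of radius `R` around `0`. -/
structure IsLagWindow (R L : ℝ≥0) (K : EuclideanSpace ℝ (Fin d) → ℝ) : Prop where
  nonneg : ∀ u, 0 ≤ K u
  le_one : ∀ u, K u ≤ 1
  lipschitz : LipschitzWith L K
  norm_le : ∀ u, K u ≠ 0 → ‖u‖ ≤ R

theorem KernelAssumption.exists_isLagWindow (hK : KernelAssumption K) :
    ∃ R L, IsLagWindow R L K := by
  obtain ⟨L, hL⟩ := hK.lipschitz
  obtain ⟨R, hR, hsub⟩ := hK.isBounded_supp.subset_closedBall_lt 0 0
  exact ⟨⟨R, hR.le⟩, L, hK.nonneg, hK.le_one, hL, fun u hu => mem_closedBall_zero_iff.1 <|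
    hsub ((hK.nonneg u).lt_of_ne' hu)⟩

theorem IsLagWindow.abs_le_one (hK : IsLagWindow R L K) (u : EuclideanSpace ℝ (Fin d)) :
    |K u| ≤ 1 := by
  rw [abs_of_nonneg (hK.nonneg u)]
  exact hK.le_one u

theorem IsLagWindow.continuous_comp_smul (hK : IsLagWindow R L K) (c : ℝ) :
    Continuous fun h => K (c • h) :=
  hK.lipschitz.continuous.comp (continuous_const_smul c)

theorem IsLagWindow.norm_le_of_ne_zero (hK : IsLagWindow R L K) {Δ : ℝ} (hΔ : 0 < Δ)
    {h : EuclideanSpace ℝ (Fin d)} (hh : K (Δ⁻¹ • h) ≠ 0) : ‖h‖ ≤ R * Δ := by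
  have hnorm := hK.norm_le _ hh
  rwa [norm_smul, norm_inv, Real.norm_of_nonneg hΔ.le, inv_mul_le_iff₀ hΔ, mul_comm] at hnorm

theorem IsLagWindow.abs_sub_le (hK : IsLagWindow R L K) {Δ : ℝ} (hΔ : 1 ≤ Δ)
    (h h' : EuclideanSpace ℝ (Fin d)) : |K (Δ⁻¹ • h') - K (Δ⁻¹ • h)| ≤ L * ‖h' - h‖ := by
  have hlip := hK.lipschitz.dist_le_mul (Δ⁻¹ • h') (Δ⁻¹ • h)
  rw [Real.dist_eq, dist_eq_norm, ← smul_sub, norm_smul, norm_inv,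
    Real.norm_of_nonneg (zero_le_one.trans hΔ)] at hlip
  refine hlip.trans ?_
  gcongr
  exact mul_le_of_le_one_left (norm_nonneg _) (inv_le_one_of_one_le₀ hΔ)

end LagWindow

section Admissible

variable {d n : ℕ} {R : ℝ≥0} {t : Fin n → EuclideanSpace ℝ (Fin d)} {Δ : ℝ}

/-- A design to which the finite-sample bounds apply at bandwidth `Δ`: the region contains a ball
that is large compared to the lags `h` with `‖h‖ ≤ R Δ`, those with a positive weight in the
estimator. The margin `2` leaves room for moving the two end points of a lag within their cells. -/
structure IsAdmissible (R : ℝ≥0) (t : Fin n → EuclideanSpace ℝ (Fin d)) (Δ : ℝ) : Prop where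
  injective : Function.Injective t
  one_le : 1 ≤ Δ
  tessDiam_le_one : tessDiam t ≤ 1
  exists_closedBall_subset : ∃ x₀ ρ, 1 ≤ ρ ∧ 2 * d * (R * Δ + 2) ≤ ρ ∧
    Metric.closedBall x₀ ρ ⊆ region t

theorem SamplingAssumption.eventually_isAdmissible
    {t : (n : ℕ) → Fin n → EuclideanSpace ℝ (Fin d)} (hS : SamplingAssumption t) {Δ : ℕ → ℝ}
    (hΔ : Tendsto Δ atTop atTop)
    (hΔvol : Tendsto (fun n => Δ n ^ d / regionVol (t n)) atTop (𝓝 0)) (R : ℝ≥0) :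
    ∀ᶠ n in atTop, IsAdmissible R (t n) (Δ n) := by
  have hA : 1 ≤ 2 * d * (R + 2 : ℝ) + 1 := le_add_of_nonneg_left (by positivity)
  filter_upwards [hS.eventually_closedBall_subset hΔvol (zero_lt_one.trans_le hA),
    hΔ.eventually_ge_atTop 1, hS.diam_tendsto.eventually (ge_mem_nhds zero_lt_one)]
    with n ⟨x₀, hball⟩ hΔ1 hdiam
  refine ⟨hS.distinct n, hΔ1, hdiam, x₀, _, one_le_mul_of_one_le_of_one_le hA hΔ1, ?_, hball⟩
  calc 2 * d * (R * Δ n + 2) ≤ 2 * d * (R * Δ n + 2 * Δ n) := by gcongr; linarith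
    _ ≤ (2 * d * (R + 2) + 1) * Δ n := by linarith

theorem IsAdmissible.pos (ht : IsAdmissible R t Δ) : 0 < Δ := zero_lt_one.trans_le ht.one_le

theorem IsAdmissible.regionVol_pos (ht : IsAdmissible R t Δ) : 0 < regionVol t := by
  obtain ⟨x₀, ρ, hρ, -, hball⟩ := ht.exists_closedBall_subset
  have hpos : 0 < volume (region t) :=
    (Metric.measure_closedBall_pos volume x₀ (zero_lt_one.trans_le hρ)).trans_le
      (measure_mono hball)
  exact ENNReal.toReal_pos hpos.ne' (isCompact_region t).measure_lt_top.ne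

theorem IsAdmissible.half_regionVol_le_overlapVol (ht : IsAdmissible R t Δ)
    {h : EuclideanSpace ℝ (Fin d)} (hh : ‖h‖ ≤ R * Δ + 2) :
    regionVol t / 2 ≤ overlapVol t h := by
  obtain ⟨x₀, ρ, hρ, hRρ, hball⟩ := ht.exists_closedBall_subset
  exact SpectralDensity.half_regionVol_le_overlapVol (zero_lt_one.trans_le hρ) hball
    (hRρ.trans' (by gcongr))

theorem IsAdmissible.abs_overlapVol_sub_le (ht : IsAdmissible R t Δ)
    (h h' : EuclideanSpace ℝ (Fin d)) :
    |overlapVol t h - overlapVol t h'| ≤ d * ‖h - h'‖ * regionVol t := by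
  obtain ⟨x₀, ρ, hρ, -, hball⟩ := ht.exists_closedBall_subset
  refine (SpectralDensity.abs_overlapVol_sub_le (zero_lt_one.trans_le hρ) hball h h').trans ?_
  have := ht.regionVol_pos
  gcongr
  exact div_le_self (norm_nonneg _) hρ

end Admissible

section LagWeight

variable {d n : ℕ} {K : EuclideanSpace ℝ (Fin d) → ℝ} {t : Fin n → EuclideanSpace ℝ (Fin d)}
  {Δ : ℝ} {R L : ℝ≥0}

/-- The kernel at lag `h` with the edge correction of the estimator, `K(h/Δ) / |T ∩ (T - h)|`. -/
def edgeCorrectedKernel (K : EuclideanSpace ℝ (Fin d) → ℝ)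
    (t : Fin n → EuclideanSpace ℝ (Fin d)) (Δ : ℝ) (h : EuclideanSpace ℝ (Fin d)) : ℝ :=
  K (Δ⁻¹ • h) / overlapVol t h

/-- The weight `e^{i hᵀθ} K(h/Δ) / |T ∩ (T - h)|` of the lag `h` in the estimator. -/
def lagWeight (K : EuclideanSpace ℝ (Fin d) → ℝ) (t : Fin n → EuclideanSpace ℝ (Fin d)) (Δ : ℝ)
    (θ h : EuclideanSpace ℝ (Fin d)) : ℂ :=
  character h θ * (edgeCorrectedKernel K t Δ h : ℂ)

theorem abs_edgeCorrectedKernel_le (hK : IsLagWindow R L K) (ht : IsAdmissible R t Δ)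
    (h : EuclideanSpace ℝ (Fin d)) : |edgeCorrectedKernel K t Δ h| ≤ 2 / regionVol t := by
  have hvol := ht.regionVol_pos
  rw [edgeCorrectedKernel]
  by_cases hzero : K (Δ⁻¹ • h) = 0
  · rw [hzero, zero_div, abs_zero]
    positivity
  have hov := ht.half_regionVol_le_overlapVol
    ((hK.norm_le_of_ne_zero ht.pos hzero).trans (by linarith))
  calc |K (Δ⁻¹ • h) / overlapVol t h| ≤ 1 / (regionVol t / 2) := by
        rw [abs_div, abs_of_pos (hov.trans_lt' (half_pos hvol))]
        gcongr
        exact hK.abs_le_one _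
    _ = 2 / regionVol t := one_div_div _ _

theorem overlapVol_mul_edgeCorrectedKernel (hK : IsLagWindow R L K) (ht : IsAdmissible R t Δ)
    (h : EuclideanSpace ℝ (Fin d)) :
    overlapVol t h * edgeCorrectedKernel K t Δ h = K (Δ⁻¹ • h) := by
  have hvol := ht.regionVol_pos
  rw [edgeCorrectedKernel]
  by_cases hzero : K (Δ⁻¹ • h) = 0
  · rw [hzero, zero_div, mul_zero]
  have hov := ht.half_regionVol_le_overlapVol
    ((hK.norm_le_of_ne_zero ht.pos hzero).trans (by linarith))
  exact mul_div_cancel₀ _ (by linarith)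

theorem abs_div_sub_div_le {a a' c p p' : ℝ} (hc : 0 < c) (hp : c ≤ p) (hp' : c ≤ p')
    (ha : |a| ≤ 1) : |a' / p' - a / p| ≤ |a' - a| / c + |p' - p| / c ^ 2 := by
  have hp0 : 0 < p := hc.trans_le hp
  have hp0' : 0 < p' := hc.trans_le hp'
  calc |a' / p' - a / p| = |(a' - a) / p' + a * ((p - p') / (p' * p))| := by
        congr 1
        field_simp
        ring
    _ ≤ |a' - a| / p' + |a| * (|p' - p| / (p' * p)) := by
        refine (abs_add_le _ _).trans_eq ?_
        rw [abs_div, abs_of_pos hp0', abs_mul, abs_div, abs_of_pos (mul_pos hp0' hp0),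
          abs_sub_comm p]
    _ ≤ |a' - a| / c + 1 * (|p' - p| / (c * c)) := by gcongr
    _ = |a' - a| / c + |p' - p| / c ^ 2 := by rw [one_mul, sq]

theorem abs_edgeCorrectedKernel_sub_le (hK : IsLagWindow R L K) (ht : IsAdmissible R t Δ)
    {h h' : EuclideanSpace ℝ (Fin d)} (hh : ‖h' - h‖ ≤ 2) :
    |edgeCorrectedKernel K t Δ h' - edgeCorrectedKernel K t Δ h| ≤
      (2 * L + 4 * d) * ‖h' - h‖ / regionVol t := by
  have hvol := ht.regionVol_pos
  rw [edgeCorrectedKernel, edgeCorrectedKernel]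
  by_cases hzero : K (Δ⁻¹ • h) = 0 ∧ K (Δ⁻¹ • h') = 0
  · rw [hzero.1, hzero.2, zero_div, zero_div, sub_zero, abs_zero]
    positivity
  have hnear : ‖h‖ ≤ R * Δ + 2 ∧ ‖h'‖ ≤ R * Δ + 2 := by
    rcases not_and_or.1 hzero with hne | hne
    · have := hK.norm_le_of_ne_zero ht.pos hne
      constructor <;> linarith [norm_le_norm_add_norm_sub' h' h]
    · have := hK.norm_le_of_ne_zero ht.pos hne
      constructor <;> linarith [norm_le_norm_add_norm_sub h' h]
  calc |K (Δ⁻¹ • h') / overlapVol t h' - K (Δ⁻¹ • h) / overlapVol t h|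
      ≤ |K (Δ⁻¹ • h') - K (Δ⁻¹ • h)| / (regionVol t / 2)
          + |overlapVol t h' - overlapVol t h| / (regionVol t / 2) ^ 2 :=
        abs_div_sub_div_le (half_pos hvol) (ht.half_regionVol_le_overlapVol hnear.1)
          (ht.half_regionVol_le_overlapVol hnear.2) (hK.abs_le_one _)
    _ ≤ L * ‖h' - h‖ / (regionVol t / 2)
          + d * ‖h' - h‖ * regionVol t / (regionVol t / 2) ^ 2 := by
        gcongr
        exacts [hK.abs_sub_le ht.one_le h h', ht.abs_overlapVol_sub_le h' h]
    _ = (2 * L + 4 * d) * ‖h' - h‖ / regionVol t := by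
        field_simp
        ring

theorem measurable_lagWeight (hK : IsLagWindow R L K) (θ : EuclideanSpace ℝ (Fin d)) :
    Measurable (lagWeight K t Δ θ) :=
  (continuous_character θ).measurable.mul
    (((hK.continuous_comp_smul _).measurable.div measurable_overlapVol).complex_ofReal)

theorem norm_lagWeight_le (hK : IsLagWindow R L K) (ht : IsAdmissible R t Δ)
    (θ h : EuclideanSpace ℝ (Fin d)) : ‖lagWeight K t Δ θ h‖ ≤ 2 / regionVol t := by
  rw [lagWeight, norm_mul, norm_character, one_mul, Complex.norm_real]
  exact abs_edgeCorrectedKernel_le hK ht h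

theorem norm_lagWeight_sub_le (hK : IsLagWindow R L K) (ht : IsAdmissible R t Δ)
    {h h' : EuclideanSpace ℝ (Fin d)} (hh : ‖h' - h‖ ≤ 2) (θ : EuclideanSpace ℝ (Fin d)) :
    ‖lagWeight K t Δ θ h' - lagWeight K t Δ θ h‖ ≤
      (2 * ‖θ‖ + 2 * L + 4 * d) * ‖h' - h‖ / regionVol t := by
  calc ‖lagWeight K t Δ θ h' - lagWeight K t Δ θ h‖
      = ‖(character h' θ - character h θ) * (edgeCorrectedKernel K t Δ h' : ℂ)
          + character h θ *
            ((edgeCorrectedKernel K t Δ h' - edgeCorrectedKernel K t Δ h : ℝ) : ℂ)‖ := by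
        rw [lagWeight, lagWeight, Complex.ofReal_sub]
        ring_nf
    _ ≤ ‖character h' θ - character h θ‖ * |edgeCorrectedKernel K t Δ h'|
          + |edgeCorrectedKernel K t Δ h' - edgeCorrectedKernel K t Δ h| := by
        refine (norm_add_le _ _).trans_eq ?_
        rw [norm_mul, norm_mul, norm_character, one_mul, Complex.norm_real, Complex.norm_real,
          Real.norm_eq_abs, Real.norm_eq_abs]
    _ ≤ ‖θ‖ * ‖h' - h‖ * (2 / regionVol t) + (2 * L + 4 * d) * ‖h' - h‖ / regionVol t := by
        gcongr
        exacts [norm_character_sub_le h h' θ, abs_edgeCorrectedKernel_le hK ht h',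
          abs_edgeCorrectedKernel_sub_le hK ht hh]
    _ = (2 * ‖θ‖ + 2 * L + 4 * d) * ‖h' - h‖ / regionVol t := by ring

end LagWeight

/-! ### Second-order bounds for stationary processes -/

section Stationary

variable {d n : ℕ} {ι H Ω : Type*} [NormedAddCommGroup H] [InnerProductSpace ℂ H]
  [MeasurableSpace Ω] {b : HilbertBasis ι ℂ H} {P : Measure Ω}
  {X : EuclideanSpace ℝ (Fin d) → Ω → H}
  {t : Fin n → EuclideanSpace ℝ (Fin d)} {γ δ : ℝ}

theorem IsSecondOrderStationary.covOp_eq (hX : IsSecondOrderStationary b P X)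
    (s u : EuclideanSpace ℝ (Fin d)) : covOp P (X s) (X u) = stationaryCov P X (s - u) := by
  rw [stationaryCov, ← hX.cov_shift (s - u) 0 u, sub_add_cancel, zero_add]

theorem CumulantAssumption.cum_eq (hV : CumulantAssumption b P X)
    (s u w v : EuclideanSpace ℝ (Fin d)) :
    cum b P (X s) (X u) (X w) (X v) = cum b P (X (s - v)) (X (u - v)) (X (w - v)) (X 0) := by
  simpa only [sub_add_cancel, zero_add] using hV.stationary (s - v) (u - v) (w - v) 0 v

/-- The integral of the fourth-order cumulants of `X` that the cumulant assumption requires to be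
finite for some `δ > 0`. -/
def cumBound (b : HilbertBasis ι ℂ H) (P : Measure Ω) (X : EuclideanSpace ℝ (Fin d) → Ω → H)
    (δ : ℝ) : ℝ≥0∞ :=
  ⨆ w, ∫⁻ u, ∫⁻ v, ⨆ l₁ ∈ Metric.ball (0 : EuclideanSpace ℝ (Fin d)) δ,
    ⨆ l₂ ∈ Metric.ball (0 : EuclideanSpace ℝ (Fin d)) δ,
    ⨆ l₃ ∈ Metric.ball (0 : EuclideanSpace ℝ (Fin d)) δ,
      ‖cum b P (X (l₁ + u)) (X (l₂ + v)) (X (l₃ + w)) (X 0)‖ₑ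

theorem CumulantAssumption.sum_volume_cell_mul_sum_enorm_cum_le (hV : CumulantAssumption b P X)
    (ht : Function.Injective t) (hδ : tessDiam t < δ) (s u : EuclideanSpace ℝ (Fin d)) :
    ∑ i, volume (cell t i) * ∑ j, volume (cell t j) *
      ‖cum b P (X (t i)) (X (t j)) (X s) (X u)‖ₑ ≤ cumBound b P X δ := by
  simp only [hV.cum_eq _ _ s u]
  exact (sum_volume_cell_mul_sum_le_lintegral_iSup ht
    (fun x y z => ‖cum b P (X x) (X y) (X z) (X 0)‖ₑ) hδ u (s - u)).trans
    (le_iSup_of_le (s - u) le_rfl)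

variable [CompleteSpace H]

theorem IsSecondOrderStationary.enorm_outerCov_le [Countable ι]
    (hX : IsSecondOrderStationary b P X) (hreal : IsRealProcess b P X)
    (s u v w : EuclideanSpace ℝ (Fin d)) :
    ‖outerCov b P (X s) (X u) (X v) (X w)‖ₑ ≤ ‖cum b P (X s) (X u) (X v) (X w)‖ₑ
      + hsTraceNorm b (stationaryCov P X (v - s)) * hsTraceNorm b (stationaryCov P X (u - w))
      + hsTraceNorm b (stationaryCov P X (v - u)) * hsTraceNorm b (stationaryCov P X (s - w)) := by
  have hbound := SpectralDensity.enorm_outerCov_le b (hX.memLp s) (hX.memLp u) (hX.memLp v)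
    (hX.memLp w) (hreal u) (hreal w)
  simp only [hX.covOp_eq] at hbound
  rwa [mul_comm (hsTraceNorm b (stationaryCov P X (s - w)))] at hbound

theorem CovarianceAssumption.exists_lintegral_traceOsc_le (hC : CovarianceAssumption b P X γ) :
    ∃ M : ℝ≥0, ∃ δ₀ > (0 : ℝ), ∀ δ : ℝ, 0 ≤ δ → δ ≤ δ₀ →
      ∫⁻ x, traceOsc b (stationaryCov P X) δ x ≤ M * ENNReal.ofReal (δ ^ γ) := by
  obtain ⟨M, δ₀, hδ₀, hM⟩ := hC.holder
  refine ⟨M, δ₀, hδ₀, fun δ hδ hle => ?_⟩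
  rcases hδ.eq_or_lt with rfl | hpos
  · simp [traceOsc, traceNorm, CFC.abs_zero]
  · exact hM δ hpos hle

theorem CovarianceAssumption.lintegral_hsTraceNorm_lt_top (hC : CovarianceAssumption b P X γ) :
    ∫⁻ h, hsTraceNorm b (stationaryCov P X h) < ∞ := by
  refine (lintegral_mono fun h => hsTraceNorm_le b _).trans_lt ?_
  rw [lintegral_const_mul' _ _ ENNReal.ofNat_ne_top]
  exact ENNReal.mul_lt_top ENNReal.ofNat_lt_top hC.integrable

theorem CovarianceAssumption.integrable_stationaryCov (hC : CovarianceAssumption b P X γ) :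
    Integrable (stationaryCov P X) :=
  ⟨hC.aestronglyMeasurable,
    (lintegral_mono fun _ => enorm_le_traceNorm b _).trans_lt hC.integrable⟩

/-- The sum of the bounds for the cumulant and for the two covariance products in the moment
`𝔼⟨X(t₁) ⊗ X(t₂), X(t₃) ⊗ X(t₄)⟩`, each summed over two of the four locations. -/
def varianceBound (b : HilbertBasis ι ℂ H) (P : Measure Ω) (X : EuclideanSpace ℝ (Fin d) → Ω → H)
    (t : Fin n → EuclideanSpace ℝ (Fin d)) (δ : ℝ) : ℝ≥0∞ :=
  cumBound b P X δ + 2 * ((∫⁻ h, hsTraceNorm b (stationaryCov P X h))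
    + 2 * ∫⁻ h, traceOsc b (stationaryCov P X) (tessDiam t) h) ^ 2

variable [Countable ι] {χ : Fin n → Fin n → ℝ≥0∞} {Q : ℝ≥0∞}

theorem sum_weight_mul_enorm_outerCov_le (hX : IsSecondOrderStationary b P X)
    (hreal : IsRealProcess b P X) (hV : CumulantAssumption b P X)
    (hC : AEStronglyMeasurable (stationaryCov P X)) (ht : Function.Injective t)
    (hδ : tessDiam t < δ) (hχ : ∀ i j, χ i j ≤ 1)
    (hQ : ∑ i, ∑ j, volume (cell t i) * volume (cell t j) * χ i j ≤ Q) :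
    ∑ i, ∑ j, ∑ k, ∑ l, (volume (cell t i) * volume (cell t j) * χ i j) *
        (volume (cell t k) * volume (cell t l) * χ k l) *
        ‖outerCov b P (X (t i)) (X (t j)) (X (t k)) (X (t l))‖ₑ ≤
      Q * varianceBound b P X t δ := by
  refine le_trans ?_ (sum_weight_mul_weight_mul_add_le hχ hQ
    (c := fun i j k l => ‖cum b P (X (t i)) (X (t j)) (X (t k)) (X (t l))‖ₑ)
    (a := fun i j => hsTraceNorm b (stationaryCov P X (t i - t j)))
    (fun k l => hV.sum_volume_cell_mul_sum_enorm_cum_le ht hδ (t k) (t l))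
    (fun i => sum_volume_cell_mul_hsTraceNorm_le b ht hC (MeasurableEquiv.subRight (t i))
      (IsometryEquiv.subRight (t i)).isometry (measurePreserving_sub_right volume (t i)))
    fun i => sum_volume_cell_mul_hsTraceNorm_le b ht hC (MeasurableEquiv.subLeft (t i))
      (IsometryEquiv.subLeft (t i)).isometry (Measure.measurePreserving_sub_left volume (t i)))
  gcongr
  exact hX.enorm_outerCov_le hreal _ _ _ _

theorem lintegral_hsNorm_weighted_sum_sq_le [IsProbabilityMeasure P]
    (hX : IsSecondOrderStationary b P X) (hreal : IsRealProcess b P X)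
    (hV : CumulantAssumption b P X) (hC : AEStronglyMeasurable (stationaryCov P X))
    (ht : Function.Injective t) (hδ : tessDiam t < δ) (hχ : ∀ i j, χ i j ≤ 1)
    (hQ : ∑ i, ∑ j, volume (cell t i) * volume (cell t j) * χ i j ≤ Q) {w : Fin n → Fin n → ℂ}
    {m : ℝ≥0∞} (hw : ∀ i j, ‖w i j‖ₑ ≤ m * (volume (cell t i) * volume (cell t j) * χ i j)) :
    ∫⁻ ω, hsNorm b (∑ i, ∑ j, w i j •
        (outer (X (t i) ω) (X (t j) ω) - stationaryCov P X (t i - t j))) ^ 2 ∂P ≤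
      m ^ 2 * (Q * varianceBound b P X t δ) := by
  have hvar := lintegral_hsNorm_sum_sub_covOp_sq_le (P := P) b
    (fun p : Fin n × Fin n => w p.1 p.2) (Y := fun p => X (t p.1)) (Z := fun p => X (t p.2))
    (fun p => hV.memLp _) (fun p => hV.memLp _)
  simp only [Fintype.sum_prod_type, hX.covOp_eq] at hvar
  refine hvar.trans ((Finset.sum_le_sum fun i _ => Finset.sum_le_sum fun j _ =>
    Finset.sum_le_sum fun k _ => Finset.sum_le_sum fun l _ =>
      mul_le_mul_left (mul_le_mul' (hw i j) (hw k l)) _).trans ?_)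
  simp only [mul_mul_mul_comm m, ← sq, mul_assoc (m ^ 2), ← Finset.mul_sum]
  exact mul_le_mul_right (sum_weight_mul_enorm_outerCov_le hX hreal hV hC ht hδ hχ hQ) _

end Stationary

/-! ### Decomposition of the estimation error -/

section IntegralDecomposition

variable {d : ℕ} {E : Type*} [NormedAddCommGroup E] [NormedSpace ℂ E]
  {K : EuclideanSpace ℝ (Fin d) → ℝ} {R L : ℝ≥0} {Δ : ℝ} {C : EuclideanSpace ℝ (Fin d) → E}

theorem mem_smul_kernelSupp (hΔ : 0 < Δ) {h : EuclideanSpace ℝ (Fin d)} :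
    h ∈ Δ • kernelSupp K ↔ 0 < K (Δ⁻¹ • h) :=
  Set.mem_smul_set_iff_inv_smul_mem₀ hΔ.ne' _ _

theorem measurableSet_smul_kernelSupp (hK : IsLagWindow R L K) (hΔ : 0 < Δ) :
    MeasurableSet (Δ • kernelSupp K) := by
  rw [Set.ext fun h => mem_smul_kernelSupp hΔ]
  exact (isOpen_lt continuous_const (hK.continuous_comp_smul _)).measurableSet

theorem integrable_character_mul_smul (hC : Integrable C) {q : EuclideanSpace ℝ (Fin d) → ℝ}
    (hq : Continuous q) (hq1 : ∀ h, |q h| ≤ 1) (θ : EuclideanSpace ℝ (Fin d)) :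
    Integrable fun h => (character h θ * (q h : ℂ)) • C h := by
  have hcont := continuous_character θ
  refine hC.bdd_smul 1 (by fun_prop) (Eventually.of_forall fun h => ?_)
  rw [norm_mul, norm_character, one_mul, Complex.norm_real]
  exact hq1 h

theorem integral_character_smul_eq (hC : Integrable C) (hK : IsLagWindow R L K) (hΔ : 0 < Δ)
    (θ : EuclideanSpace ℝ (Fin d)) :
    ∫ h, character h θ • C h = (∫ h, (character h θ * (K (Δ⁻¹ • h) : ℂ)) • C h)
      + (∫ h in Δ • kernelSupp K, (character h θ * ((1 - K (Δ⁻¹ • h) : ℝ) : ℂ)) • C h)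
      + ∫ h in (Δ • kernelSupp K)ᶜ, character h θ • C h := by
  have hcont := hK.continuous_comp_smul Δ⁻¹
  have hchar : Integrable fun h => character h θ • C h := by
    simpa using integrable_character_mul_smul hC (continuous_const (y := 1)) (fun _ => abs_one.le) θ
  have hker := integrable_character_mul_smul hC hcont (fun h => hK.abs_le_one _) θ
  have hcompl : Integrable fun h => (character h θ * ((1 - K (Δ⁻¹ • h) : ℝ) : ℂ)) • C h :=
    integrable_character_mul_smul hC (q := fun h => 1 - K (Δ⁻¹ • h)) (continuous_const.sub hcont)
      (fun h => abs_le.2 ⟨by linarith [hK.le_one (Δ⁻¹ • h)], by linarith [hK.nonneg (Δ⁻¹ • h)]⟩) θ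
  have hsupp : ∫ h in Δ • kernelSupp K, (character h θ * (K (Δ⁻¹ • h) : ℂ)) • C h =
      ∫ h, (character h θ * (K (Δ⁻¹ • h) : ℂ)) • C h := by
    refine setIntegral_eq_integral_of_forall_compl_eq_zero fun h hh => ?_
    rw [mem_smul_kernelSupp hΔ, not_lt] at hh
    rw [le_antisymm hh (hK.nonneg _), Complex.ofReal_zero, mul_zero, zero_smul]
  rw [← hsupp, ← integral_add hker.integrableOn hcompl.integrableOn,
    ← integral_add_compl (measurableSet_smul_kernelSupp hK hΔ) hchar]
  congr 2 with h
  rw [← add_smul, ← mul_add, ← Complex.ofReal_add, add_sub_cancel, Complex.ofReal_one, mul_one]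

end IntegralDecomposition

section ErrorDecomposition

variable {d n : ℕ} {ι H Ω : Type*} [NormedAddCommGroup H] [InnerProductSpace ℂ H]
  {K : EuclideanSpace ℝ (Fin d) → ℝ} {R L : ℝ≥0}

/-- The weight of the pair of locations `i`, `j` in the unnormalised estimator. -/
def pairWeight (K : EuclideanSpace ℝ (Fin d) → ℝ) (t : Fin n → EuclideanSpace ℝ (Fin d)) (Δ : ℝ)
    (θ : EuclideanSpace ℝ (Fin d)) (i j : Fin n) : ℂ :=
  lagWeight K t Δ θ (t i - t j) * (volume.real (cell t i) * volume.real (cell t j) : ℝ)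

theorem estimator_eq (X : EuclideanSpace ℝ (Fin d) → Ω → H) (K : EuclideanSpace ℝ (Fin d) → ℝ)
    (t : Fin n → EuclideanSpace ℝ (Fin d)) (Δ : ℝ) (θ : EuclideanSpace ℝ (Fin d)) (ω : Ω) :
    estimator X K t Δ θ ω = (((2 * Real.pi) ^ d : ℝ)⁻¹ : ℂ) •
      ∑ i, ∑ j, pairWeight K t Δ θ i j • outer (X (t i) ω) (X (t j) ω) := by
  have hweight : ∀ i j, character (t i - t j) θ * ((K (Δ⁻¹ • (t i - t j)) *
      volume.real (cell t i) * volume.real (cell t j) / overlapVol t (t i - t j) : ℝ) : ℂ) =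
      pairWeight K t Δ θ i j := fun i j => by
    rw [pairWeight, lagWeight, edgeCorrectedKernel]
    push_cast
    ring
  simp only [estimator, hweight]

variable [MeasurableSpace Ω] {P : Measure Ω} {X : EuclideanSpace ℝ (Fin d) → Ω → H}

/-- The mean of the unnormalised estimator minus the kernel-weighted integral that it
approximates. -/
def samplingBias (P : Measure Ω) (X : EuclideanSpace ℝ (Fin d) → Ω → H)
    (K : EuclideanSpace ℝ (Fin d) → ℝ) (t : Fin n → EuclideanSpace ℝ (Fin d)) (Δ : ℝ)
    (θ : EuclideanSpace ℝ (Fin d)) : H →L[ℂ] H :=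
  ∑ i, ∑ j, pairWeight K t Δ θ i j • stationaryCov P X (t i - t j)
    - ∫ h, (character h θ * (K (Δ⁻¹ • h) : ℂ)) • stationaryCov P X h

/-- The unnormalised estimator minus its mean. -/
def fluctuation (P : Measure Ω) (X : EuclideanSpace ℝ (Fin d) → Ω → H)
    (K : EuclideanSpace ℝ (Fin d) → ℝ) (t : Fin n → EuclideanSpace ℝ (Fin d)) (Δ : ℝ)
    (θ : EuclideanSpace ℝ (Fin d)) (ω : Ω) : H →L[ℂ] H :=
  ∑ i, ∑ j, pairWeight K t Δ θ i j •
    (outer (X (t i) ω) (X (t j) ω) - stationaryCov P X (t i - t j))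

theorem aestronglyMeasurable_fluctuation (hX : ∀ s, AEStronglyMeasurable (X s) P)
    (K : EuclideanSpace ℝ (Fin d) → ℝ) (t : Fin n → EuclideanSpace ℝ (Fin d)) (Δ : ℝ)
    (θ : EuclideanSpace ℝ (Fin d)) : AEStronglyMeasurable (fluctuation P X K t Δ θ) P :=
  Finset.aestronglyMeasurable_fun_sum _ fun i _ => Finset.aestronglyMeasurable_fun_sum _ fun j _ =>
    ((aestronglyMeasurable_outer (hX (t i)) (hX (t j))).sub
      aestronglyMeasurable_const).const_smul (pairWeight K t Δ θ i j)

theorem rpow_half_lintegral_mul_add_sq_le [IsProbabilityMeasure P] {f : Ω → ℝ≥0∞}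
    (hf : AEMeasurable f P) {c : ℝ≥0∞} (hc : c ≠ ∞) (β : ℝ≥0∞) :
    (∫⁻ ω, (c * (f ω + β)) ^ 2 ∂P) ^ (1 / 2 : ℝ) ≤
      c * ((∫⁻ ω, f ω ^ 2 ∂P) ^ (1 / 2 : ℝ) + β) := by
  have hsqrt : ∀ x : ℝ≥0∞, (x ^ 2) ^ (1 / 2 : ℝ) = x := fun x => by
    rw [← ENNReal.rpow_natCast, ← ENNReal.rpow_mul]
    norm_num
  have hminkowski := ENNReal.lintegral_Lp_add_le (μ := P) (p := 2) hf
    (aemeasurable_const (b := β)) one_le_two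
  simp only [Pi.add_apply, lintegral_const, measure_univ, mul_one, ENNReal.rpow_ofNat,
    hsqrt] at hminkowski
  simp only [mul_pow]
  rw [lintegral_const_mul' _ _ (ENNReal.pow_ne_top hc),
    ENNReal.mul_rpow_of_nonneg _ _ one_half_pos.le, hsqrt]
  gcongr

variable [CompleteSpace H] {b : HilbertBasis ι ℂ H}

theorem hsNorm_estimator_sub_spectralDensity_le (hC : Integrable (stationaryCov P X))
    (hK : IsLagWindow R L K) (t : Fin n → EuclideanSpace ℝ (Fin d)) {Δ : ℝ} (hΔ : 0 < Δ)
    (θ : EuclideanSpace ℝ (Fin d)) (ω : Ω) :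
    hsNorm b (estimator X K t Δ θ ω - spectralDensity P X θ) ≤
      ‖(((2 * Real.pi) ^ d : ℝ)⁻¹ : ℂ)‖ₑ * (hsNorm b (fluctuation P X K t Δ θ ω)
        + (hsNorm b (samplingBias P X K t Δ θ) + biasKernel b P X K Δ θ
          + biasTail b P X K Δ θ)) := by
  have hdecomp : estimator X K t Δ θ ω - spectralDensity P X θ =
      (((2 * Real.pi) ^ d : ℝ)⁻¹ : ℂ) • (fluctuation P X K t Δ θ ω + (samplingBias P X K t Δ θ
        - (∫ h in Δ • kernelSupp K,
            (character h θ * ((1 - K (Δ⁻¹ • h) : ℝ) : ℂ)) • stationaryCov P X h)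
        - ∫ h in (Δ • kernelSupp K)ᶜ, character h θ • stationaryCov P X h)) := by
    rw [estimator_eq, spectralDensity, integral_character_smul_eq hC hK hΔ θ, ← smul_sub,
      fluctuation, samplingBias]
    simp_rw [smul_sub (pairWeight K t Δ θ _ _), Finset.sum_sub_distrib]
    congr 1
    abel
  rw [hdecomp, hsNorm_smul]
  gcongr
  refine (hsNorm_add_le b _ _).trans (add_le_add le_rfl ?_)
  exact (hsNorm_sub_le b _ _).trans (add_le_add (hsNorm_sub_le b _ _) le_rfl)

theorem rootMSE_le [IsProbabilityMeasure P] (hX : ∀ s, AEStronglyMeasurable (X s) P)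
    (hC : Integrable (stationaryCov P X)) (hK : IsLagWindow R L K)
    (t : Fin n → EuclideanSpace ℝ (Fin d)) {Δ : ℝ} (hΔ : 0 < Δ) (θ : EuclideanSpace ℝ (Fin d)) :
    rootMSE b P X K t Δ θ ≤ ‖(((2 * Real.pi) ^ d : ℝ)⁻¹ : ℂ)‖ₑ *
      ((∫⁻ ω, hsNorm b (fluctuation P X K t Δ θ ω) ^ 2 ∂P) ^ (1 / 2 : ℝ)
        + (hsNorm b (samplingBias P X K t Δ θ) + biasKernel b P X K Δ θ
          + biasTail b P X K Δ θ)) := by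
  have hmeas : AEMeasurable (fun ω => hsNorm b (fluctuation P X K t Δ θ ω)) P :=
    (lowerSemicontinuous_hsNorm b).measurable.comp_aemeasurable
      (aestronglyMeasurable_fluctuation hX K t Δ θ).aemeasurable
  refine le_trans ?_ (rpow_half_lintegral_mul_add_sq_le hmeas enorm_ne_top _)
  rw [rootMSE]
  gcongr with ω
  exact hsNorm_estimator_sub_spectralDensity_le hC hK t hΔ θ ω

end ErrorDecomposition

/-! ### Rates for the sampling bias and the fluctuation -/

section SamplingBias

variable {d n : ℕ} {ι H Ω : Type*} [NormedAddCommGroup H] [InnerProductSpace ℂ H]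
  {K : EuclideanSpace ℝ (Fin d) → ℝ}
  {t : Fin n → EuclideanSpace ℝ (Fin d)} {Δ γ : ℝ} {R L : ℝ≥0}

theorem ofReal_regionVol (t : Fin n → EuclideanSpace ℝ (Fin d)) :
    ENNReal.ofReal (regionVol t) = volume (region t) :=
  ofReal_measureReal (isCompact_region t).measure_lt_top.ne

theorem hsNorm_smul_sub_smul_le (b : HilbertBasis ι ℂ H) (p q : ℂ) (A B : H →L[ℂ] H) :
    hsNorm b (p • A - q • B) ≤ ‖p - q‖ₑ * hsNorm b B + ‖p‖ₑ * hsNorm b (A - B) := by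
  rw [← hsNorm_smul, ← hsNorm_smul]
  refine le_of_eq_of_le ?_ (hsNorm_add_le b _ _)
  rw [sub_smul, smul_sub, add_comm, sub_add_sub_cancel]

variable [CompleteSpace H] [MeasurableSpace Ω] {b : HilbertBasis ι ℂ H} {P : Measure Ω}
  {X : EuclideanSpace ℝ (Fin d) → Ω → H}

theorem hsNorm_lagWeight_smul_sub_le (b : HilbertBasis ι ℂ H)
    (C : EuclideanSpace ℝ (Fin d) → H →L[ℂ] H) (hK : IsLagWindow R L K) (ht : IsAdmissible R t Δ)
    {h h' : EuclideanSpace ℝ (Fin d)} (hh : ‖h' - h‖ ≤ 2 * tessDiam t)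
    (θ : EuclideanSpace ℝ (Fin d)) :
    hsNorm b (lagWeight K t Δ θ h' • C h' - lagWeight K t Δ θ h • C h) ≤
      ENNReal.ofReal ((4 * ‖θ‖ + 4 * L + 8 * d) * tessDiam t / regionVol t) * hsTraceNorm b (C h)
        + ENNReal.ofReal (2 / regionVol t) * traceOsc b C (2 * tessDiam t) h := by
  have hvol := ht.regionVol_pos
  refine (hsNorm_smul_sub_smul_le b _ _ _ _).trans (add_le_add (mul_le_mul' ?_ ?_)
    (mul_le_mul' ?_ ?_))
  · rw [← ofReal_norm]
    refine ENNReal.ofReal_le_ofReal ((norm_lagWeight_sub_le hK ht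
      (hh.trans (by linarith [ht.tessDiam_le_one])) θ).trans ?_)
    calc (2 * ‖θ‖ + 2 * L + 4 * d) * ‖h' - h‖ / regionVol t
        ≤ (2 * ‖θ‖ + 2 * L + 4 * d) * (2 * tessDiam t) / regionVol t := by gcongr
      _ = (4 * ‖θ‖ + 4 * L + 8 * d) * tessDiam t / regionVol t := by ring
  · exact hsNorm_le_hsTraceNorm b _
  · rw [← ofReal_norm]
    exact ENNReal.ofReal_le_ofReal (norm_lagWeight_le hK ht θ h')
  · exact (hsNorm_le_traceNorm b _).trans (traceNorm_sub_le_traceOsc b hh)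

theorem hsNorm_samplingBias_le_lintegral (hC : Integrable (stationaryCov P X))
    (hK : IsLagWindow R L K) (ht : IsAdmissible R t Δ) (θ : EuclideanSpace ℝ (Fin d)) :
    hsNorm b (samplingBias P X K t Δ θ) ≤
      ENNReal.ofReal ((4 * ‖θ‖ + 4 * L + 8 * d) * tessDiam t) *
          (∫⁻ h, hsTraceNorm b (stationaryCov P X h))
        + 2 * ∫⁻ h, traceOsc b (stationaryCov P X) (2 * tessDiam t) h := by
  set C := stationaryCov P X with hCdef
  have hvol := ht.regionVol_pos
  -- The edge correction is the reciprocal of the overlap volume, so they cancel exactly.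
  have hcancel : ∀ h, overlapVol t h • lagWeight K t Δ θ h • C h =
      (character h θ * (K (Δ⁻¹ • h) : ℂ)) • C h := fun h => by
    rw [← Complex.coe_smul, smul_smul, lagWeight, mul_left_comm, ← Complex.ofReal_mul,
      overlapVol_mul_edgeCorrectedKernel hK ht]
  have hbias : samplingBias P X K t Δ θ =
      ∑ i, ∑ j, (volume.real (cell t i) * volume.real (cell t j)) •
        lagWeight K t Δ θ (t i - t j) • C (t i - t j)
      - ∫ h, overlapVol t h • lagWeight K t Δ θ h • C h := by
    simp only [hcancel, samplingBias, pairWeight, mul_comm (lagWeight K t Δ θ _), mul_smul,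
      Complex.coe_smul, ← hCdef]
  have hint : Integrable fun h => overlapVol t h • lagWeight K t Δ θ h • C h := by
    simp only [hcancel]
    exact integrable_character_mul_smul hC (hK.continuous_comp_smul _) (fun h => hK.abs_le_one _) θ
  rw [hbias]
  refine (hsNorm_sum_smul_sub_integral_le b ht.injective
    ((measurable_lagWeight hK θ).aestronglyMeasurable.smul hC.1) hint
    fun x h hxh => hsNorm_lagWeight_smul_sub_le b C hK ht hxh θ).trans_eq ?_
  rw [lintegral_add_left' ((aemeasurable_hsTraceNorm b hC.1).const_mul _),
    lintegral_const_mul' _ _ ENNReal.ofReal_ne_top, lintegral_const_mul' _ _ ENNReal.ofReal_ne_top,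
    ← ofReal_regionVol, mul_add, ← mul_assoc, ← mul_assoc, ← ENNReal.ofReal_mul hvol.le,
    ← ENNReal.ofReal_mul hvol.le, mul_div_cancel₀ _ hvol.ne', mul_div_cancel₀ _ hvol.ne',
    ENNReal.ofReal_ofNat]

theorem hsNorm_samplingBias_le (hC : CovarianceAssumption b P X γ) (hK : IsLagWindow R L K)
    (ht : IsAdmissible R t Δ) {M : ℝ≥0}
    (hM : ∫⁻ x, traceOsc b (stationaryCov P X) (2 * tessDiam t) x ≤
      M * ENNReal.ofReal ((2 * tessDiam t) ^ γ)) (θ : EuclideanSpace ℝ (Fin d)) :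
    hsNorm b (samplingBias P X K t Δ θ) ≤
      (ENNReal.ofReal (4 * ‖θ‖ + 4 * L + 8 * d) * (∫⁻ h, hsTraceNorm b (stationaryCov P X h))
        + 4 * M) * ENNReal.ofReal (tessDiam t ^ γ) := by
  have hδ := tessDiam_nonneg t
  have hlinear : tessDiam t ≤ tessDiam t ^ γ :=
    Real.self_le_rpow_of_le_one hδ ht.tessDiam_le_one hC.gamma_le_one
  have hdouble : (2 * tessDiam t) ^ γ ≤ 2 * tessDiam t ^ γ := by
    rw [Real.mul_rpow zero_le_two hδ]
    gcongr
    exact Real.rpow_le_self_of_one_le one_le_two hC.gamma_le_one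
  calc hsNorm b (samplingBias P X K t Δ θ)
      ≤ ENNReal.ofReal ((4 * ‖θ‖ + 4 * L + 8 * d) * tessDiam t ^ γ) *
            (∫⁻ h, hsTraceNorm b (stationaryCov P X h))
          + 2 * (M * ENNReal.ofReal (2 * tessDiam t ^ γ)) := by
        refine (hsNorm_samplingBias_le_lintegral hC.integrable_stationaryCov hK ht θ).trans ?_
        gcongr
        exact hM.trans (by gcongr)
    _ = _ := by
        rw [ENNReal.ofReal_mul (by positivity), ENNReal.ofReal_mul zero_le_two,
          ENNReal.ofReal_ofNat]
        ring

theorem exists_hsNorm_samplingBias_le (hC : CovarianceAssumption b P X γ)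
    (hK : IsLagWindow R L K) {t : (n : ℕ) → Fin n → EuclideanSpace ℝ (Fin d)}
    (hS : SamplingAssumption t) {Δ : ℕ → ℝ} (ht : ∀ᶠ n in atTop, IsAdmissible R (t n) (Δ n))
    {Θ : Set (EuclideanSpace ℝ (Fin d))} (hΘ : Bornology.IsBounded Θ) :
    ∃ c : ℝ≥0, ∀ᶠ n in atTop, ∀ θ ∈ Θ,
      hsNorm b (samplingBias P X K (t n) (Δ n) θ) ≤ c * ENNReal.ofReal (tessDiam (t n) ^ γ) := by
  obtain ⟨τ, hτ⟩ := hΘ.exists_norm_le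
  obtain ⟨M, δ₀, hδ₀, hM⟩ := hC.exists_lintegral_traceOsc_le
  have hfinite : ENNReal.ofReal (4 * τ + 4 * L + 8 * d) *
      (∫⁻ h, hsTraceNorm b (stationaryCov P X h)) + 4 * M ≠ ∞ := by
    have := hC.lintegral_hsTraceNorm_lt_top
    finiteness
  obtain ⟨c, hc⟩ : ∃ c : ℝ≥0, (c : ℝ≥0∞) = _ := ⟨_, ENNReal.coe_toNNReal hfinite⟩
  refine ⟨c, ?_⟩
  filter_upwards [ht, hS.diam_tendsto.eventually (ge_mem_nhds (half_pos hδ₀))] with n hn hδ θ hθ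
  refine (hsNorm_samplingBias_le hC hK hn (hM _ ?_ (by linarith)) θ).trans ?_
  · exact mul_nonneg zero_le_two (tessDiam_nonneg _)
  · rw [hc]
    gcongr
    exact hτ θ hθ

end SamplingBias

section Fluctuation

variable {d n : ℕ} {K : EuclideanSpace ℝ (Fin d) → ℝ} {t : Fin n → EuclideanSpace ℝ (Fin d)}
  {Δ γ δ : ℝ} {R L : ℝ≥0}

theorem enorm_pairWeight_le (hK : IsLagWindow R L K) (ht : IsAdmissible R t Δ)
    (θ : EuclideanSpace ℝ (Fin d)) (i j : Fin n) :
    ‖pairWeight K t Δ θ i j‖ₑ ≤ ENNReal.ofReal (2 / regionVol t) *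
      (volume (cell t i) * volume (cell t j) *
        (Metric.closedBall (0 : EuclideanSpace ℝ (Fin d)) (R * Δ)).indicator 1 (t i - t j)) := by
  rw [pairWeight]
  by_cases hzero : K (Δ⁻¹ • (t i - t j)) = 0
  · simp [lagWeight, edgeCorrectedKernel, hzero]
  have hmem : t i - t j ∈ Metric.closedBall (0 : EuclideanSpace ℝ (Fin d)) (R * Δ) :=
    mem_closedBall_zero_iff.2 (hK.norm_le_of_ne_zero ht.pos hzero)
  rw [Set.indicator_of_mem hmem, Pi.one_apply, mul_one, enorm_mul]
  refine mul_le_mul' ?_ (le_of_eq ?_)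
  · rw [← ofReal_norm]
    exact ENNReal.ofReal_le_ofReal (norm_lagWeight_le hK ht θ _)
  · rw [← ofReal_norm, Complex.norm_real, Real.norm_of_nonneg (by positivity),
      ENNReal.ofReal_mul measureReal_nonneg, ofReal_measureReal (volume_cell_lt_top t i).ne,
      ofReal_measureReal (volume_cell_lt_top t j).ne]

theorem volume_closedBall_add_tessDiam_le (ht : IsAdmissible R t Δ) :
    volume (Metric.closedBall (0 : EuclideanSpace ℝ (Fin d)) (R * Δ + tessDiam t)) ≤
      ENNReal.ofReal ((R + 1) ^ d * Δ ^ d) *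
        volume (Metric.ball (0 : EuclideanSpace ℝ (Fin d)) 1) := by
  have hΔ := ht.pos
  have hδ := tessDiam_nonneg t
  rw [Measure.addHaar_closedBall _ _ (by positivity), finrank_euclideanSpace_fin, ← mul_pow]
  gcongr
  linarith [ht.one_le, ht.tessDiam_le_one]

variable {ι H Ω : Type*} [NormedAddCommGroup H] [InnerProductSpace ℂ H] [CompleteSpace H]
  [MeasurableSpace Ω] {b : HilbertBasis ι ℂ H} {P : Measure Ω}
  {X : EuclideanSpace ℝ (Fin d) → Ω → H}

theorem varianceBound_le (hC : CovarianceAssumption b P X γ) (hδ : tessDiam t ≤ 1) {M : ℝ≥0}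
    (hM : ∫⁻ x, traceOsc b (stationaryCov P X) (tessDiam t) x ≤
      M * ENNReal.ofReal (tessDiam t ^ γ)) :
    varianceBound b P X t δ ≤
      cumBound b P X δ + 2 * ((∫⁻ h, hsTraceNorm b (stationaryCov P X h)) + 2 * M) ^ 2 := by
  rw [varianceBound]
  gcongr
  exact hM.trans <| mul_le_of_le_one_right zero_le <|
    ENNReal.ofReal_le_one.2 (Real.rpow_le_one (tessDiam_nonneg t) hδ hC.gamma_pos.le)

variable [Countable ι] [IsProbabilityMeasure P]

theorem lintegral_hsNorm_fluctuation_sq_le (hX : IsSecondOrderStationary b P X)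
    (hreal : IsRealProcess b P X) (hV : CumulantAssumption b P X)
    (hC : AEStronglyMeasurable (stationaryCov P X)) (hK : IsLagWindow R L K)
    (ht : IsAdmissible R t Δ) (hδ : tessDiam t < δ) (θ : EuclideanSpace ℝ (Fin d)) :
    ∫⁻ ω, hsNorm b (fluctuation P X K t Δ θ ω) ^ 2 ∂P ≤
      ENNReal.ofReal (4 * (R + 1) ^ d) * volume (Metric.ball (0 : EuclideanSpace ℝ (Fin d)) 1) *
        varianceBound b P X t δ * ENNReal.ofReal (Δ ^ d / regionVol t) := by
  have hvol := ht.regionVol_pos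
  have hΔ := ht.pos
  set B := volume (Metric.ball (0 : EuclideanSpace ℝ (Fin d)) 1)
  have hconst : ENNReal.ofReal (2 / regionVol t) ^ 2 * ENNReal.ofReal (regionVol t) *
      ENNReal.ofReal ((R + 1) ^ d * Δ ^ d) =
      ENNReal.ofReal (4 * (R + 1) ^ d) * ENNReal.ofReal (Δ ^ d / regionVol t) := by
    rw [← ENNReal.ofReal_pow (by positivity), ← ENNReal.ofReal_mul (by positivity),
      ← ENNReal.ofReal_mul (by positivity), ← ENNReal.ofReal_mul (by positivity)]
    congr 1
    field_simp
    ring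
  have hvar := lintegral_hsNorm_weighted_sum_sq_le hX hreal hV hC ht.injective hδ
    (χ := fun i j => (Metric.closedBall 0 (R * Δ)).indicator 1 (t i - t j))
    (fun i j => Set.indicator_le_self' (fun _ _ => zero_le) _)
    (sum_volume_cell_mul_indicator_le ht.injective _) (enorm_pairWeight_le hK ht θ)
  calc ∫⁻ ω, hsNorm b (fluctuation P X K t Δ θ ω) ^ 2 ∂P
      ≤ ENNReal.ofReal (2 / regionVol t) ^ 2 * (volume (region t) *
          volume (Metric.closedBall (0 : EuclideanSpace ℝ (Fin d)) (R * Δ + tessDiam t)) *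
          varianceBound b P X t δ) := hvar
    _ ≤ ENNReal.ofReal (2 / regionVol t) ^ 2 * (ENNReal.ofReal (regionVol t) *
          (ENNReal.ofReal ((R + 1) ^ d * Δ ^ d) * B) * varianceBound b P X t δ) := by
        rw [ofReal_regionVol]
        gcongr
        exact volume_closedBall_add_tessDiam_le ht
    _ = ENNReal.ofReal (2 / regionVol t) ^ 2 * ENNReal.ofReal (regionVol t) *
          ENNReal.ofReal ((R + 1) ^ d * Δ ^ d) * (B * varianceBound b P X t δ) := by ring
    _ = _ := by rw [hconst]; ring

theorem exists_rpow_half_lintegral_hsNorm_fluctuation_sq_le (hX : IsSecondOrderStationary b P X)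
    (hreal : IsRealProcess b P X) (hV : CumulantAssumption b P X)
    (hC : CovarianceAssumption b P X γ) (hK : IsLagWindow R L K)
    {t : (n : ℕ) → Fin n → EuclideanSpace ℝ (Fin d)} (hS : SamplingAssumption t) {Δ : ℕ → ℝ}
    (ht : ∀ᶠ n in atTop, IsAdmissible R (t n) (Δ n)) :
    ∃ c : ℝ≥0, ∀ᶠ n in atTop, ∀ θ,
      (∫⁻ ω, hsNorm b (fluctuation P X K (t n) (Δ n) θ ω) ^ 2 ∂P) ^ (1 / 2 : ℝ) ≤
        c * ENNReal.ofReal √(Δ n ^ d / regionVol (t n)) := by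
  obtain ⟨M, δ₀, hδ₀, hM⟩ := hC.exists_lintegral_traceOsc_le
  obtain ⟨δ, hδ, hcum⟩ := hV.integrable
  have hfinite : ENNReal.ofReal (4 * (R + 1) ^ d) *
      volume (Metric.ball (0 : EuclideanSpace ℝ (Fin d)) 1) *
        (cumBound b P X δ + 2 * ((∫⁻ h, hsTraceNorm b (stationaryCov P X h)) + 2 * M) ^ 2) ≠ ∞ := by
    have hI := hC.lintegral_hsTraceNorm_lt_top
    exact ENNReal.mul_ne_top (ENNReal.mul_ne_top ENNReal.ofReal_ne_top measure_ball_lt_top.ne)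
      (ENNReal.add_ne_top.2 ⟨hcum.ne, by finiteness⟩)
  obtain ⟨A, hA⟩ : ∃ A : ℝ≥0, (A : ℝ≥0∞) = _ := ⟨_, ENNReal.coe_toNNReal hfinite⟩
  refine ⟨A ^ (1 / 2 : ℝ), ?_⟩
  filter_upwards [ht, hS.diam_tendsto.eventually (ge_mem_nhds hδ₀),
    hS.diam_tendsto.eventually (gt_mem_nhds hδ)] with n hn hn₀ hnδ θ
  have hratio : 0 ≤ Δ n ^ d / regionVol (t n) :=
    div_nonneg (pow_nonneg hn.pos.le d) hn.regionVol_pos.le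
  rw [ENNReal.coe_rpow_of_nonneg _ one_half_pos.le, Real.sqrt_eq_rpow,
    ← ENNReal.ofReal_rpow_of_nonneg hratio one_half_pos.le,
    ← ENNReal.mul_rpow_of_nonneg _ _ one_half_pos.le]
  gcongr
  refine (lintegral_hsNorm_fluctuation_sq_le hX hreal hV hC.aestronglyMeasurable hK hn hnδ
    θ).trans ?_
  rw [hA]
  gcongr
  exact varianceBound_le hC hn.tessDiam_le_one (hM _ (tessDiam_nonneg _) hn₀)

end Fluctuation

theorem add_le_mul_add_of_le {x y p q r s c₁ c₂ : ℝ≥0∞} (hx : x ≤ c₂ * s) (hy : y ≤ c₁ * p) :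
    x + (y + q + r) ≤ (c₁ + c₂ + 1) * (p + q + r + s) := by
  calc x + (y + q + r) ≤ c₂ * s + (c₁ * p + 1 * q + 1 * r) := by
        rw [one_mul, one_mul]
        gcongr
    _ ≤ (c₁ + c₂ + 1) * s + ((c₁ + c₂ + 1) * p + (c₁ + c₂ + 1) * q + (c₁ + c₂ + 1) * r) := by
        gcongr
        exacts [le_add_self.trans le_self_add, le_self_add.trans le_self_add, le_add_self,
          le_add_self]
    _ = (c₁ + c₂ + 1) * (p + q + r + s) := by ring

end SpectralDensity

end

open SpectralDensity in
theorem mainTheorem4_general {d : ℕ} {ι H Ω : Type*}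
    [NormedAddCommGroup H] [InnerProductSpace ℂ H] [CompleteSpace H]
    [TopologicalSpace.SeparableSpace H] (b : HilbertBasis ι ℂ H)
    [MeasurableSpace Ω] (P : Measure Ω) [IsProbabilityMeasure P]
    (X : EuclideanSpace ℝ (Fin d) → Ω → H) (hX : IsSecondOrderStationary b P X)
    (hreal : IsRealProcess b P X) (γ : ℝ) (hC : CovarianceAssumption b P X γ)
    (K : EuclideanSpace ℝ (Fin d) → ℝ) {R L : ℝ≥0} (hK : IsLagWindow R L K)
    (t : (n : ℕ) → Fin n → EuclideanSpace ℝ (Fin d)) (hS : SamplingAssumption t)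
    (hV : CumulantAssumption b P X) (Δ : ℕ → ℝ) (hΔ : Tendsto Δ atTop atTop)
    (hΔvol : Tendsto (fun n => Δ n ^ d / regionVol (t n)) atTop (𝓝 0))
    (Θ : Set (EuclideanSpace ℝ (Fin d))) (hΘ : Bornology.IsBounded Θ) :
    ∃ M : ℝ≥0, ∀ᶠ n in atTop, ∀ θ ∈ Θ,
      rootMSE b P X K (t n) (Δ n) θ ≤ M * (ENNReal.ofReal (tessDiam (t n) ^ γ)
        + biasKernel b P X K (Δ n) θ + biasTail b P X K (Δ n) θ
        + ENNReal.ofReal √(Δ n ^ d / regionVol (t n))) := by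
  have : Countable ι := countable_of_orthonormal b.orthonormal
  have ht := hS.eventually_isAdmissible hΔ hΔvol R
  obtain ⟨c₁, hbias⟩ := exists_hsNorm_samplingBias_le hC hK hS ht hΘ
  obtain ⟨c₂, hfluct⟩ :=
    exists_rpow_half_lintegral_hsNorm_fluctuation_sq_le hX hreal hV hC hK hS ht
  refine ⟨‖(((2 * Real.pi) ^ d : ℝ)⁻¹ : ℂ)‖₊ * (c₁ + c₂ + 1), ?_⟩
  filter_upwards [ht, hbias, hfluct] with n hn hbias_n hfluct_n θ hθ
  refine (rootMSE_le (fun s => (hX.memLp s).1) hC.integrable_stationaryCov hK (t n) hn.pos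
    θ).trans ?_
  rw [ENNReal.coe_mul, mul_assoc]
  exact mul_le_mul_right (add_le_mul_add_of_le (hfluct_n θ) (hbias_n θ hθ)) _

theorem mainTheorem4 {d : ℕ} {ι H Ω : Type*}
    [NormedAddCommGroup H] [InnerProductSpace ℂ H] [CompleteSpace H]
    [TopologicalSpace.SeparableSpace H] (b : HilbertBasis ι ℂ H)
    [MeasurableSpace Ω] (P : Measure Ω) [IsProbabilityMeasure P]
    (X : EuclideanSpace ℝ (Fin d) → Ω → H)
    (hX : SpectralDensity.IsSecondOrderStationary b P X)
    (hreal : SpectralDensity.IsRealProcess b P X)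
    (γ : ℝ) (hC : SpectralDensity.CovarianceAssumption b P X γ)
    (K : EuclideanSpace ℝ (Fin d) → ℝ) (hK : SpectralDensity.KernelAssumption K)
    (t : (n : ℕ) → Fin n → EuclideanSpace ℝ (Fin d))
    (hS : SpectralDensity.SamplingAssumption t)
    (hV : SpectralDensity.CumulantAssumption b P X)
    (Δ : ℕ → ℝ) (hΔpos : ∀ n, 0 < Δ n) (hΔ : Tendsto Δ atTop atTop)
    (hΔsupp : ∀ᶠ n in atTop, Δ n • SpectralDensity.kernelSupp K ⊆
      SpectralDensity.region (t n) - SpectralDensity.region (t n))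
    (hΔvol : Tendsto (fun n => Δ n ^ d / SpectralDensity.regionVol (t n)) atTop (𝓝 0))
    (Θ : Set (EuclideanSpace ℝ (Fin d))) (hΘ : Bornology.IsBounded Θ) :
    ∃ M : ℝ≥0, ∀ᶠ n in atTop, ∀ θ ∈ Θ,
      SpectralDensity.rootMSE b P X K (t n) (Δ n) θ ≤
        M * (ENNReal.ofReal (SpectralDensity.tessDiam (t n) ^ γ)
          + SpectralDensity.biasKernel b P X K (Δ n) θ
          + SpectralDensity.biasTail b P X K (Δ n) θ
          + ENNReal.ofReal (Real.sqrt (Δ n ^ d / SpectralDensity.regionVol (t n)))) := by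
  obtain ⟨R, L, hKRL⟩ := hK.exists_isLagWindow
  exact mainTheorem4_general b P X hX hreal γ hC K hKRL t hS hV Δ hΔ hΔvol Θ hΘ
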